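/- **Setting.** Let $(\mathbf X_i,Z_i,A_i,Y_i)$, $i\ge 1$, be i.i.d. copies of $(\mathbf X,Z,A,Y)$ with covariates $\mathbf X\in\mathcal X\subseteq\mathbb R^d$, binary instrument $Z$, binary treatment $A$ and outcome $Y\in\mathbb R$. Let $L\le U$ be the (measurable) lower and upper endpoint functions of a partial identification interval $[L(\mathbf x),U(\mathbf x)]$. With $t^+=\max(t,0)$, define the surrogate loss of $f:\mathcal X\to\mathbb R$ at $\mathbf x$ to be: $|U|(1-f)^+$ if $L>0$; $|L|(1+f)^+$ if $U<0$; $|L|+(|U|-|L|)(1-f)^+$ if $0\in[L,U]$ and $|U|\ge|L|$; $|U|+(|L|-|U|)(1+f)^+$ if $0\in[L,U]$ and $|U|<|L|$ (all functions evaluated at $\mathbf x$). Let $\mathcal R^{\rm h}_{\rm upper}(f)$ be its expectation at $\mathbf X$. **Estimator.** Let $I_1,I_2$ be a random partition of $\{1,\dots,n\}$, independent of the data, with $|I_1|\asymp|I_2|\asymp n/2$. Estimates $\widehat L,\widehat U$ of $L,U$ are constructed from the observations in $I_1$ (possibly with auxiliary randomization independent of the data). With $\operatorname{sgn}(t)=1$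 for $t\ge0$ and $-1$ for $t<0$, put $$\widehat w=|\widehat U|\mathbf 1\{\widehat L>0\}+|\widehat L|\mathbf 1\{\widehat U<0\}+\big||\widehat U|-|\widehat L|\big|\mathbf 1\{0\in[\widehat L,\widehat U]\},$$ $$\widehat e=\mathbf 1\{\widehat U<0\}-\mathbf 1\{\widehat L>0\}-\operatorname{sgn}(|\widehat U|-|\widehat L|)\mathbf 1\{0\in[\widehat L,\widehat U]\}.$$ Let $\mathcal F$ be a class of measurable functions on $\mathcal X$ contained in a vector space of functions with a norm $\|\cdot\|$, let $\lambda_n>0$ be deterministic with $\lambda_n\to0$, and let $\widehat f_n^{\lambda_n}$ be a (measurable) minimizer over $f\in\mathcal F$ of $$\frac1{|I_2|}\sum_{i\in I_2}\widehat w(\mathbf X_i)\{1+\widehat e(\mathbf X_i)f(\mathbf X_i)\}^++\frac{\lambda_n}{2}\|f\|^2 .$$ **Assumptions.** 1. There is $f^*_{\mathcal F}\in\mathcal F$ with $\mathcal R^{\rm h}_{\rm upper}(f^*_{\mathcal F})=\inf_{f\in\mathcal F}\mathcal R^{\rm h}_{\rm upper}(f)$. 2. For constants $M_1>0$, $M_2$: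 $|L(\mathbf X)|,|U(\mathbf X)|,|Y|\le M_1$ and all coordinates of $\mathbf X$ are at most $M_2$ in absolute value, with probability 1. 3. For a constant $M_3$ not depending on $n$: $|\widehat L(\mathbf X)|,|\widehat U(\mathbf X)|\le M_3$ with probability 1, where $\mathbf X$ is independent of the sample and the randomization. 4. There are $\mathcal F_0\subseteq\mathcal F$ and constants $C_0>0$, $0<v<2$ such that $\mathcal F=\{af:f\in\mathcal F_0,a\in\mathbb R\}$; with probability 1, $\widehat f_n^{\lambda_n}=af$ for some $f\in\mathcal F_0$ and $|a|\le C_0\lambda_n^{-1}$; and $\sup_P\log N\{\epsilon,\mathcal F_0,L_2(P)\}\le O(\epsilon^{-v})$ for all $0<\epsilon<1$, the supremum being over all probability measures $P$ on $\mathcal X$, where $N\{\epsilon,\mathcal F_0,L_2(P)\}$ is the minimal number of closed $L_2(P)$-balls of radius $\epsilon$ that cover $\mathcal F_0$. 5. $\mathbb E|\widehat L(\mathbf X)-L(\mathbf X)|=O(n^{-\alpha})$ and $\mathbb E|\widehat U(\mathbf X)-U(\mathbf X)|=O(n^{-\beta})$, the expectation being over the sample, the randomization and an independent $\mathbf X$.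 6. There is a constant $M_4>0$ with $\|f\|\ge M_4\|f\|_\infty$ for all $f\in\mathcal F$, where $\|f\|_\infty=\sup_{\mathbf x\in\mathcal X}|f(\mathbf x)|$. **Theorem.** Under these assumptions, with $\mathbb E$ the expectation over the sample and the randomization, $\mathcal R^{\rm h}_{\rm upper}(\widehat f_n^{\lambda_n})$ is integrable and, as $n\to\infty$, $$\mathbb E\big[\mathcal R^{\rm h}_{\rm upper}(\widehat f_n^{\lambda_n})\big]-\inf_{f\in\mathcal F}\mathcal R^{\rm h}_{\rm upper}(f)\le O\Big(\lambda_n+n^{-1/2}\lambda_n^{-1}+\lambda_n^{-1/2}\big(n^{-\alpha}+n^{-\beta}\big)\Big).$$ -/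

import Mathlib

open MeasureTheory Filter Topology Asymptotics
open scoped NNReal ENNReal

namespace IVPILE

/-- One observation `(X, Z, A, Y)`: covariates in `𝒳 ⊆ ℝ^d`, a binary instrument, a binary
treatment (both coded as `Bool`, `true` for `+1` and `false` for `-1`) and a real outcome. -/
abbrev Obs {d : ℕ} (𝒳 : Set (Fin d → ℝ)) : Type := ↥𝒳 × Bool × Bool × ℝ

/-- The covariates of an observation. -/
def Obs.cov {d : ℕ} {𝒳 : Set (Fin d → ℝ)} (o : Obs 𝒳) : ↥𝒳 := o.1

/-- The outcome of an observation. -/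
def Obs.outcome {d : ℕ} {𝒳 : Set (Fin d → ℝ)} (o : Obs 𝒳) : ℝ := o.2.2.2

/-- The law of the covariates when an observation has law `μ`. -/
noncomputable def covLaw {d : ℕ} {𝒳 : Set (Fin d → ℝ)} (μ : Measure (Obs 𝒳)) : Measure ↥𝒳 :=
  μ.map Obs.cov

/-- Positive part `t⁺`. -/
noncomputable def pos (t : ℝ) : ℝ := max t 0

/-- The sign with the convention `sgn 0 = 1`. -/
noncomputable def sgn (t : ℝ) : ℝ := if 0 ≤ t then 1 else -1

/-- The weight `|u| 1{l > 0} + |l| 1{u < 0} + ||u| - |l|| 1{0 ∈ [l, u]}` of an interval `[l, u]`. -/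
noncomputable def weight (l u : ℝ) : ℝ :=
  (if 0 < l then |u| else 0) + (if u < 0 then |l| else 0)
    + (if (0 : ℝ) ∈ Set.Icc l u then |(|u| - |l|)| else 0)

/-- The label `1{u < 0} - 1{l > 0} - sgn(|u| - |l|) 1{0 ∈ [l, u]}` of an interval `[l, u]`. -/
noncomputable def label (l u : ℝ) : ℝ :=
  (if u < 0 then 1 else 0) - (if 0 < l then 1 else 0)
    - (if (0 : ℝ) ∈ Set.Icc l u then sgn (|u| - |l|) else 0)

/-- The surrogate loss of the prediction value `t` at a point whose identification interval is
`[l, u]`: a scaled hinge loss if `0 ∉ [l, u]`, a lifted and scaled hinge loss otherwise. -/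
noncomputable def surrogateLoss (l u t : ℝ) : ℝ :=
  if 0 < l then |u| * pos (1 - t)
  else if u < 0 then |l| * pos (1 + t)
  else if |l| ≤ |u| then |l| + (|u| - |l|) * pos (1 - t)
  else |u| + (|l| - |u|) * pos (1 + t)

/-- The surrogate risk `E[surrogateLoss (L X) (U X) (f X)]` of a rule `f`. -/
noncomputable def surrogateRisk {d : ℕ} {𝒳 : Set (Fin d → ℝ)} (μ : Measure (Obs 𝒳))
    (L U f : ↥𝒳 → ℝ) : ℝ :=
  ∫ x, surrogateLoss (L x) (U x) (f x) ∂(covLaw μ)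

/-- The penalized empirical risk over the observations with index in `I`, with weights and labels
computed from the (estimated) interval endpoints `l` and `u`, penalty level `lam` and norm `N`. -/
noncomputable def empiricalObjective {d : ℕ} {𝒳 : Set (Fin d → ℝ)} {H : Submodule ℝ (↥𝒳 → ℝ)}
    (N : Seminorm ℝ H) {n : ℕ} (I : Finset (Fin n)) (l u : ↥𝒳 → ℝ) (lam : ℝ)
    (s : Fin n → Obs 𝒳) (f : H) : ℝ :=
  (I.card : ℝ)⁻¹ * ∑ i ∈ I, weight (l (s i).cov) (u (s i).cov)
      * pos (1 + label (l (s i).cov) (u (s i).cov) * (f : ↥𝒳 → ℝ) (s i).cov)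
    + lam / 2 * N f ^ 2

/-- The classes in `L²(P)` of the members of a set `S` of functions. -/
def l2Classes {α : Type*} [MeasurableSpace α] (P : Measure α) (S : Set (α → ℝ)) :
    Set (Lp ℝ 2 P) :=
  {g | ∃ f ∈ S, ⇑g =ᵐ[P] f}

/-- The covering number `N{ε, S, L₂(P)}`: the least number of closed `L²(P)`-balls of radius `ε`
that cover `S` (the centres need not belong to `S`). -/
noncomputable def l2CoveringNumber {α : Type*} [MeasurableSpace α] (ε : ℝ≥0) (S : Set (α → ℝ))
    (P : Measure α) : ℕ∞ :=
  Metric.externalCoveringNumber ε (l2Classes P S)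

/-- Uniform entropy bound with exponent `v`: there is a `K` such that
`log N{ε, S, L₂(P)} ≤ K ε^(-v)` for all `0 < ε < 1` and all probability measures `P`. -/
def HasUniformEntropy {α : Type*} [MeasurableSpace α] (S : Set (α → ℝ)) (v : ℝ) : Prop :=
  ∃ K : ℝ, ∀ ε : ℝ≥0, 0 < ε → ε < 1 → ∀ P : Measure α, IsProbabilityMeasure P →
    l2CoveringNumber ε S P ≠ ⊤ ∧
      Real.log ((l2CoveringNumber ε S P).toNat : ℝ) ≤ K * (ε : ℝ) ^ (-v)

/-- The joint law of the auxiliary randomization (law `ν`: random partition, randomized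
estimators) and of an independent i.i.d. sample of size `n` from `μ`. -/
noncomputable def sampleLaw {d : ℕ} {𝒳 : Set (Fin d → ℝ)} {Ξ : Type*} [MeasurableSpace Ξ]
    (ν : Measure Ξ) (μ : Measure (Obs 𝒳)) (n : ℕ) : Measure (Ξ × (Fin n → Obs 𝒳)) :=
  ν.prod (Measure.pi fun _ => μ)

/-- A sequence of random real functions on `𝒳`, computed from the auxiliary randomness and the
sample. -/
abbrev FunEstimator {d : ℕ} (𝒳 : Set (Fin d → ℝ)) (Ξ : Type*) : Type _ :=
  (n : ℕ) → Ξ → (Fin n → Obs 𝒳) → ↥𝒳 → ℝ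

/-- Joint measurability in the randomness, the sample and the point. -/
def FunEstimator.IsMeasurable {d : ℕ} {𝒳 : Set (Fin d → ℝ)} {Ξ : Type*} [MeasurableSpace Ξ]
    (g : FunEstimator 𝒳 Ξ) : Prop :=
  ∀ n, Measurable fun q : (Ξ × (Fin n → Obs 𝒳)) × ↥𝒳 => g n q.1.1 q.1.2 q.2

/-- The estimator uses only those observations whose index lies in the random set `I n ξ`. -/
def FunEstimator.UsesOnly {d : ℕ} {𝒳 : Set (Fin d → ℝ)} {Ξ : Type*} (g : FunEstimator 𝒳 Ξ)
    (I : (n : ℕ) → Ξ → Finset (Fin n)) : Prop :=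
  ∀ n ξ, DependsOn (g n ξ) (I n ξ : Set (Fin n))

end IVPILE

namespace IVPILE

/-! Up to a term free of the prediction, the surrogate loss is the weighted hinge loss `hingeTerm`
(`surrogateLoss_sub_eq`). That loss, at prediction `t`, moves by at most a multiple of `1 + |t|`
times the change of the endpoints (`abs_hingeTerm_sub_hingeTerm_le`). Replacing true by estimated
endpoints in the excess risk over the minimizer f* thus costs `2 (2 + ‖f̂‖∞ + ‖f*‖∞)` times the L¹
estimation errors. Comparing the penalized objective at f̂ and at 0 gives `‖f̂‖∞ = O(λ^(-1/2))`,
whence the third term of the rate.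

With estimated endpoints, minimality of f̂ bounds its empirical risk by that of f* plus `λ/2 ‖f*‖²`,
the first term. The empirical risk of the fixed rule f* is unbiased, because the endpoints do not
use the second half of the sample. There remains the expected gap between population and empirical
risk of f̂, the second term.

This gap is symmetrized: exchanging observations of the second half with those of a ghost sample,
according to signs, preserves both the joint law and the estimated endpoints. The gap becomes an
average over signs of Rademacher sums evaluated at the rule fitted to the exchanged sample. That
rule is just some sign-dependent choice of `a f` with `|a| ≤ C₀/λ` and `f ∈ F₀`, so the chaining
bounds are stated for arbitrary selections; no supremum over the class, and no measurability of one,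
is needed. Chaining (`sum_boolSign_chaining`, `exists_rademacher_bound`) gives order `√|J| / λ`,
since `v < 2` makes the entropy series converge; division by `|J|` yields `n^(-1/2) / λ`.

All of this is done for a fixed value of the randomization (`integral_surrogateLoss_sub_le`) and
integrated at the end. -/

/-- The Rademacher sign attached to a Boolean. -/
def boolSign (b : Bool) : ℝ := if b then -1 else 1

lemma boolSign_sq (b : Bool) : boolSign b ^ 2 = 1 := by
  cases b <;> simp [boolSign]

/-! ### Rademacher sums of selections: Massart's inequality and chaining. -/

section Rademacher

variable {ι : Type*} [Fintype ι]

/-- Summing over all sign vectors factorizes over coordinates, and each factor is a doubled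
hyperbolic cosine, with `cosh x ≤ exp (x ^ 2 / 2)`. -/
lemma sum_exp_boolSign_le [DecidableEq ι] (c : ℝ) (z : ι → ℝ) :
    ∑ σ : ι → Bool, Real.exp (c * ∑ i, boolSign (σ i) * z i)
      ≤ 2 ^ Fintype.card ι * Real.exp (c ^ 2 / 2 * ∑ i, z i ^ 2) := by
  have h1 : ∑ σ : ι → Bool, Real.exp (c * ∑ i, boolSign (σ i) * z i)
      = ∏ i, ∑ b : Bool, Real.exp (c * (boolSign b * z i)) := by
    rw [Finset.prod_univ_sum, Fintype.piFinset_univ]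
    refine Finset.sum_congr rfl fun σ _ => ?_
    rw [Finset.mul_sum, Real.exp_sum]
  have h2 : ∀ i, ∑ b : Bool, Real.exp (c * (boolSign b * z i))
      ≤ 2 * Real.exp (c ^ 2 / 2 * z i ^ 2) := by
    intro i
    have := Real.cosh_le_exp_half_sq (c * z i)
    rw [Real.cosh_eq] at this
    have e : (c * z i) ^ 2 / 2 = c ^ 2 / 2 * z i ^ 2 := by ring
    rw [e] at this
    simp only [Fintype.sum_bool, boolSign]
    simp only [if_true, Bool.false_eq_true, if_false, one_mul, neg_mul, mul_neg]
    linarith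
  rw [h1]
  refine (Finset.prod_le_prod (fun i _ => by positivity) fun i _ => h2 i).trans_eq ?_
  rw [Finset.prod_mul_distrib, ← Real.exp_sum, Finset.mul_sum]
  simp

/-- Massart's finite class inequality, for a selection from a finite set of vectors. -/
lemma sum_boolSign_select_le [DecidableEq ι] {κ : Type*} (s : Finset κ) (z : κ → ι → ℝ)
    (h : (ι → Bool) → κ) (hs : ∀ σ, h σ ∈ s) {R Λ : ℝ} (hR : 0 < R) (hΛ : 0 < Λ)
    (hcard : (s.card : ℝ) ≤ Real.exp Λ) (hz : ∀ σ, ∑ i, z (h σ) i ^ 2 ≤ R ^ 2) :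
    ∑ σ : ι → Bool, ∑ i, boolSign (σ i) * z (h σ) i
      ≤ 2 ^ Fintype.card ι * (R * √(2 * Λ)) := by
  classical
  set X : (ι → Bool) → ℝ := fun σ => ∑ i, boolSign (σ i) * z (h σ) i with hX
  set M : ℝ := 2 ^ Fintype.card ι with hM
  have hMcard : ∑ _σ : ι → Bool, (1 : ℝ) = M := by simp [hM]
  set r := √(2 * Λ) with hr
  have hr0 : 0 < r := Real.sqrt_pos.2 (by linarith)
  have hrr : r ^ 2 = 2 * Λ := Real.sq_sqrt (by linarith)
  -- Chosen so that the variance exponent `c ^ 2 / 2 * R ^ 2` equals the entropy `Λ`.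
  set c := r / R with hc
  have hc0 : 0 < c := by positivity
  have hcR : c ^ 2 / 2 * R ^ 2 = Λ := by
    rw [hc, div_pow]; field_simp; linarith
  -- Only selected vectors are known to have length at most `R`, so the union bound runs over the
  -- part of `s` with that property.
  have hexp : ∑ σ, Real.exp (c * X σ) ≤ M * Real.exp (2 * Λ) := by
    calc ∑ σ, Real.exp (c * X σ)
        ≤ ∑ σ : ι → Bool, ∑ k ∈ s.filter (fun k => ∑ i, z k i ^ 2 ≤ R ^ 2),
            Real.exp (c * ∑ i, boolSign (σ i) * z k i) := by
          refine Finset.sum_le_sum fun σ _ => ?_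
          exact Finset.single_le_sum
            (f := fun k => Real.exp (c * ∑ i, boolSign (σ i) * z k i))
            (fun k _ => (Real.exp_pos _).le)
            (Finset.mem_filter.2 ⟨hs σ, hz σ⟩)
      _ = ∑ k ∈ s.filter (fun k => ∑ i, z k i ^ 2 ≤ R ^ 2), ∑ σ : ι → Bool,
            Real.exp (c * ∑ i, boolSign (σ i) * z k i) := Finset.sum_comm
      _ ≤ ∑ k ∈ s.filter (fun k => ∑ i, z k i ^ 2 ≤ R ^ 2), M * Real.exp Λ := by
          refine Finset.sum_le_sum fun k hk => (sum_exp_boolSign_le c (z k)).trans ?_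
          refine mul_le_mul_of_nonneg_left (Real.exp_le_exp.2 ?_) (by positivity)
          rw [← hcR]
          exact mul_le_mul_of_nonneg_left (Finset.mem_filter.1 hk).2 (by positivity)
      _ ≤ Real.exp Λ * (M * Real.exp Λ) := by
          rw [Finset.sum_const, nsmul_eq_mul]
          refine mul_le_mul_of_nonneg_right (le_trans ?_ hcard) (by positivity)
          exact_mod_cast Finset.card_filter_le _ _
      _ = M * Real.exp (2 * Λ) := by rw [two_mul, Real.exp_add]; ring
  -- The tangent line of `exp` at `2 * Λ` takes the place of Jensen's inequality.
  have hlin : ∑ σ, (c * X σ - 2 * Λ + 1) ≤ M := by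
    calc ∑ σ, (c * X σ - 2 * Λ + 1) ≤ ∑ σ, Real.exp (-(2 * Λ)) * Real.exp (c * X σ) := by
          refine Finset.sum_le_sum fun σ _ => ?_
          rw [← Real.exp_add]
          have := Real.add_one_le_exp (-(2 * Λ) + c * X σ)
          linarith
      _ ≤ Real.exp (-(2 * Λ)) * (M * Real.exp (2 * Λ)) := by
          rw [← Finset.mul_sum]
          exact mul_le_mul_of_nonneg_left hexp (Real.exp_pos _).le
      _ = M := by rw [mul_left_comm, ← Real.exp_add]; simp
  have hsum : ∑ σ, (c * X σ - 2 * Λ + 1) = c * ∑ σ, X σ - 2 * Λ * M + M := by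
    rw [Finset.sum_add_distrib, Finset.sum_sub_distrib, ← Finset.mul_sum, hMcard]
    simp [hM]; ring
  have h3 : c * ∑ σ, X σ ≤ M * r ^ 2 := by rw [hrr]; linarith
  have h4 : c * (M * (R * r)) = M * r ^ 2 := by rw [hc]; field_simp
  rw [← h4] at h3
  exact le_of_mul_le_mul_left h3 hc0

lemma sum_boolSign_eq_zero [DecidableEq ι] (i : ι) : ∑ σ : ι → Bool, boolSign (σ i) = 0 := by
  have h : ∑ σ : ι → Bool, boolSign (σ i) = ∑ σ : ι → Bool, -boolSign (σ i) := by
    refine Fintype.sum_equiv (Equiv.piCongrRight fun _ => Equiv.boolNot) _ _ fun σ => ?_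
    cases hσ : σ i <;> simp [boolSign, hσ]
  rw [Finset.sum_neg_distrib] at h
  linarith

/-- `A` has an `ℓ²`-net with at most `N` points (not necessarily in `A`) and squared radius `ρ`. -/
def HasNet (A : Set (ι → ℝ)) (N ρ : ℝ) : Prop :=
  ∃ s : Finset (ι → ℝ), (s.card : ℝ) ≤ N ∧ ∀ t ∈ A, ∃ t' ∈ s, ∑ i, (t i - t' i) ^ 2 ≤ ρ

/-- Dudley's chaining bound for a selection from a set of vectors, with geometric scales. -/
lemma sum_boolSign_chaining [DecidableEq ι] (A : Set (ι → ℝ)) (g : (ι → Bool) → ι → ℝ)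
    (hg : ∀ σ, g σ ∈ A) {D W K b : ℝ} (hD : 0 < D) (hW : 0 < W) (hK : 0 < K) (hb : 1 ≤ b)
    (hb4 : b < 4) (t₀ : ι → ℝ) (h0 : ∀ t ∈ A, ∑ i, (t i - t₀ i) ^ 2 ≤ D ^ 2 * W)
    (hnet : ∀ k : ℕ, HasNet A (Real.exp (K * b ^ (k + 1))) ((D / 2 ^ (k + 1)) ^ 2 * W)) :
    ∑ σ : ι → Bool, ∑ i, boolSign (σ i) * g σ i
      ≤ 2 ^ Fintype.card ι * (D * √W * (1 + 8 * √K / (1 - √b / 2))) := by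
  classical
  set M : ℝ := 2 ^ Fintype.card ι with hM
  have hM0 : 0 < M := by positivity
  have hMcard : ((Finset.univ : Finset (ι → Bool)).card : ℝ) = M := by simp [hM]
  -- The hypothesis supplies nets from scale 1 on; at scale 0 the single point `t₀` is a net. Its
  -- Rademacher sum averages to zero.
  have hnet' : ∀ k : ℕ, ∃ s : Finset (ι → ℝ), ((s.card : ℝ) ≤ Real.exp (K * b ^ k)) ∧
      (k = 0 → s = {t₀}) ∧
      ∀ t ∈ A, ∃ t' ∈ s, ∑ i, (t i - t' i) ^ 2 ≤ (D / 2 ^ k) ^ 2 * W := by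
    rintro (_ | k)
    · refine ⟨{t₀}, ?_, fun _ => rfl, fun t ht => ⟨t₀, by simp, by simpa using h0 t ht⟩⟩
      simp [hK.le]
    · obtain ⟨s, h1, h2⟩ := hnet k
      exact ⟨s, h1, by simp, h2⟩
  choose s hscard hs0 hs using hnet'
  choose r hrs hr using fun k σ => hs k (g σ) (hg σ)
  have hr0 : ∀ σ, r 0 σ = t₀ := fun σ => by
    have := hrs 0 σ; rw [hs0 0 rfl] at this; simpa using this
  have hlink : ∀ k : ℕ, ∑ σ : ι → Bool, ∑ i, boolSign (σ i) * (r (k + 1) σ i - r k σ i)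
      ≤ M * (D * √W * (8 * √K) * (√b / 2) ^ (k + 1)) := by
    intro k
    have hbk : (0 : ℝ) < b ^ (k + 1) := by positivity
    -- Links come from pairs of net points, which doubles the entropy. Their squared length is at
    -- most `2 + 2 * 4 = 10` times the finer squared radius, and `10 ≤ 4 ^ 2`.
    have := sum_boolSign_select_le (s (k + 1) ×ˢ s k) (fun p i => p.1 i - p.2 i)
      (fun σ => (r (k + 1) σ, r k σ)) (fun σ => Finset.mem_product.2 ⟨hrs _ σ, hrs _ σ⟩)
      (R := 4 * (D / 2 ^ (k + 1)) * √W) (Λ := 2 * (K * b ^ (k + 1))) (by positivity)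
      (by positivity) ?_ ?_
    · refine this.trans_eq ?_
      have e : √(2 * (2 * (K * b ^ (k + 1)))) = 2 * (√K * √b ^ (k + 1)) := by
        rw [show 2 * (2 * (K * b ^ (k + 1))) = 2 ^ 2 * (√K * √b ^ (k + 1)) ^ 2 by
          rw [mul_pow, ← pow_mul, mul_comm (k + 1), pow_mul, Real.sq_sqrt hK.le,
            Real.sq_sqrt (by linarith)]; ring]
        rw [← mul_pow, Real.sqrt_sq (by positivity)]
      rw [e, div_pow]
      field_simp
      ring
    · rw [Finset.card_product, Nat.cast_mul, two_mul, Real.exp_add]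
      refine mul_le_mul (hscard _) ((hscard k).trans (Real.exp_le_exp.2 ?_)) (by positivity)
        (by positivity)
      exact mul_le_mul_of_nonneg_left (pow_le_pow_right₀ hb (Nat.le_succ k)) hK.le
    · intro σ
      have h1 := hr (k + 1) σ
      have h2 := hr k σ
      have h3 : ∑ i, (r (k + 1) σ i - r k σ i) ^ 2
          ≤ 2 * ∑ i, (g σ i - r (k + 1) σ i) ^ 2 + 2 * ∑ i, (g σ i - r k σ i) ^ 2 := by
        rw [Finset.mul_sum, Finset.mul_sum, ← Finset.sum_add_distrib]
        refine Finset.sum_le_sum fun i _ => ?_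
        nlinarith [sq_nonneg ((g σ i - r (k + 1) σ i) + (g σ i - r k σ i))]
      have e1 : (D / 2 ^ k) ^ 2 = 4 * (D / 2 ^ (k + 1)) ^ 2 := by
        rw [pow_succ]; field_simp; ring
      have e2 : (4 * (D / 2 ^ (k + 1)) * √W) ^ 2 = 16 * ((D / 2 ^ (k + 1)) ^ 2 * W) := by
        rw [mul_pow, Real.sq_sqrt hW.le]; ring
      rw [e1] at h2
      rw [e2]
      have : 0 ≤ (D / 2 ^ (k + 1)) ^ 2 * W := by positivity
      refine h3.trans ?_
      linarith
  set n := Fintype.card ι with hn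
  -- The chain may stop at level `n`, the number of coordinates: Cauchy–Schwarz loses `√n`, which
  -- the scale `2 ^ (-n)` outweighs.
  have hres : ∀ σ, ∑ i, boolSign (σ i) * (g σ i - r n σ i) ≤ D * √W := by
    intro σ
    have hcs := Finset.sum_mul_sq_le_sq_mul_sq Finset.univ (fun i => boolSign (σ i))
      (fun i => g σ i - r n σ i)
    have hn1 : ∑ i : ι, boolSign (σ i) ^ 2 = (n : ℝ) := by simp [boolSign_sq, hn]
    rw [hn1] at hcs
    have hn2 : (n : ℝ) ≤ (2 ^ n) ^ 2 := by
      have : (n : ℝ) ≤ 2 ^ n := by exact_mod_cast Nat.lt_two_pow_self.le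
      have h1 : (1 : ℝ) ≤ 2 ^ n := one_le_pow₀ (by norm_num)
      nlinarith
    have h5 : (∑ i, boolSign (σ i) * (g σ i - r n σ i)) ^ 2 ≤ (D * √W) ^ 2 := by
      refine hcs.trans ((mul_le_mul hn2 (hr n σ) (Finset.sum_nonneg fun i _ => sq_nonneg _)
        (by positivity)).trans_eq ?_)
      rw [mul_pow, Real.sq_sqrt hW.le, div_pow]
      field_simp
    exact (abs_le_of_sq_le_sq' h5 (by positivity)).2
  have htel : ∀ σ i, g σ i = t₀ i + (∑ k ∈ Finset.range n, (r (k + 1) σ i - r k σ i))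
      + (g σ i - r n σ i) := by
    intro σ i
    rw [Finset.sum_range_sub (fun k => r k σ i), hr0]
    ring
  have hsplit : ∑ σ : ι → Bool, ∑ i, boolSign (σ i) * g σ i
      = ∑ σ : ι → Bool, ∑ i, boolSign (σ i) * t₀ i
        + ∑ k ∈ Finset.range n, ∑ σ : ι → Bool, ∑ i,
            boolSign (σ i) * (r (k + 1) σ i - r k σ i)
        + ∑ σ : ι → Bool, ∑ i, boolSign (σ i) * (g σ i - r n σ i) := by
    rw [Finset.sum_comm (s := Finset.range n), ← Finset.sum_add_distrib,
      ← Finset.sum_add_distrib]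
    refine Finset.sum_congr rfl fun σ _ => ?_
    rw [Finset.sum_comm (s := Finset.range n), ← Finset.sum_add_distrib,
      ← Finset.sum_add_distrib]
    refine Finset.sum_congr rfl fun i _ => ?_
    conv_lhs => rw [htel σ i]
    rw [← Finset.mul_sum]
    ring
  have hzero : ∑ σ : ι → Bool, ∑ i, boolSign (σ i) * t₀ i = 0 := by
    rw [Finset.sum_comm]
    refine Finset.sum_eq_zero fun i _ => ?_
    rw [← Finset.sum_mul, sum_boolSign_eq_zero, zero_mul]
  have hq0 : 0 ≤ √b / 2 := by positivity
  have hq1 : √b / 2 < 1 := by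
    have : √b < 2 := (Real.sqrt_lt' (by norm_num)).2 (by linarith)
    linarith
  have hgeo : ∑ k ∈ Finset.range n, (√b / 2) ^ (k + 1) ≤ 1 / (1 - √b / 2) := by
    have h1 : ∀ k ∈ Finset.range n, (√b / 2) ^ (k + 1) ≤ (√b / 2) ^ k := fun k _ =>
      pow_le_pow_of_le_one hq0 hq1.le (Nat.le_succ k)
    refine (Finset.sum_le_sum h1).trans ?_
    rw [one_div, ← tsum_geometric_of_lt_one hq0 hq1]
    exact (summable_geometric_of_lt_one hq0 hq1).sum_le_tsum _ fun i _ => by positivity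
  rw [hsplit, hzero, zero_add]
  have hA : ∑ k ∈ Finset.range n, ∑ σ : ι → Bool, ∑ i,
      boolSign (σ i) * (r (k + 1) σ i - r k σ i)
      ≤ M * (D * √W * (8 * √K) * (1 / (1 - √b / 2))) := by
    refine (Finset.sum_le_sum fun k _ => hlink k).trans ?_
    rw [← Finset.mul_sum, ← Finset.mul_sum]
    gcongr
  have hB : ∑ σ : ι → Bool, ∑ i, boolSign (σ i) * (g σ i - r n σ i) ≤ M * (D * √W) := by
    refine (Finset.sum_le_sum fun σ _ => hres σ).trans_eq ?_
    rw [Finset.sum_const, nsmul_eq_mul, hMcard]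
  refine (add_le_add hA hB).trans_eq ?_
  ring

end Rademacher

/-! ### From uniform entropy to Rademacher bounds, by way of empirical measures. -/

section Entropy

variable {α : Type*} [MeasurableSpace α]

/-- The uniform distribution on the points of a finite family. -/
noncomputable def empiricalMeasure {κ : Type*} [Fintype κ] (x : κ → α) : Measure α :=
  (Fintype.card κ : ℝ≥0∞)⁻¹ • Measure.sum fun i => Measure.dirac (x i)

variable {κ : Type*} [Fintype κ]

lemma isProbabilityMeasure_empiricalMeasure [Nonempty κ] (x : κ → α) :
    IsProbabilityMeasure (empiricalMeasure x) := by
  constructor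
  simp only [empiricalMeasure, Measure.smul_apply, Measure.sum_apply _ MeasurableSet.univ,
    measure_univ, tsum_fintype, Finset.sum_const, Finset.card_univ, nsmul_eq_mul, mul_one,
    smul_eq_mul]
  exact ENNReal.inv_mul_cancel (by simp) (by simp)

variable [MeasurableSingletonClass α]

lemma integral_empiricalMeasure (x : κ → α) (h : α → ℝ) :
    ∫ y, h y ∂(empiricalMeasure x) = (Fintype.card κ : ℝ)⁻¹ * ∑ i, h (x i) := by
  rw [empiricalMeasure, integral_smul_measure, Measure.sum_fintype,
    integral_finsetSum_measure fun i _ => integrable_dirac (by simp)]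
  simp

lemma ae_empiricalMeasure_iff [Nonempty κ] (x : κ → α) (p : α → Prop) :
    (∀ᵐ y ∂(empiricalMeasure x), p y) ↔ ∀ i, p (x i) := by
  have h0 : (Fintype.card κ : ℝ≥0∞)⁻¹ ≠ 0 := by simp
  rw [ae_iff, empiricalMeasure, Measure.smul_apply, smul_eq_mul, mul_eq_zero, or_iff_right h0,
    ← ae_iff, Measure.ae_sum_iff]
  simp [ae_dirac_eq]

/-- A uniform entropy bound gives nets for the values at finitely many points. -/
lemma hasNet_values [Nonempty κ] {S : Set (α → ℝ)} (hmeas : ∀ f ∈ S, Measurable f)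
    (hbdd : ∀ f ∈ S, ∃ b, ∀ y, |f y| ≤ b) {v K : ℝ}
    (hK : ∀ ε : ℝ≥0, 0 < ε → ε < 1 → ∀ P : Measure α, IsProbabilityMeasure P →
      l2CoveringNumber ε S P ≠ ⊤ ∧
        Real.log ((l2CoveringNumber ε S P).toNat : ℝ) ≤ K * (ε : ℝ) ^ (-v))
    (ε : ℝ≥0) (hε : 0 < ε) (hε1 : ε < 1) (x : κ → α) :
    HasNet {t : κ → ℝ | ∃ f ∈ S, t = fun i => f (x i)} (Real.exp (K * (ε : ℝ) ^ (-v)))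
      (Fintype.card κ * (ε : ℝ) ^ 2) := by
  classical
  have hP := isProbabilityMeasure_empiricalMeasure x
  obtain ⟨hfin, hlog⟩ := hK ε hε hε1 _ hP
  set n := l2CoveringNumber ε S (empiricalMeasure x) with hn
  -- The covering number is an infimum in `ℕ∞`; being finite it lies strictly below `n + 1`, so some
  -- cover has at most `n` points.
  obtain ⟨C, hC, hCn⟩ : ∃ C : Set (Lp ℝ 2 (empiricalMeasure x)),
      Metric.IsCover ε (l2Classes (empiricalMeasure x) S) C ∧ C.encard ≤ n := by
    have h1 : n < n + 1 := ENat.lt_add_one_iff hfin |>.2 le_rfl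
    conv_lhs at h1 => rw [hn]
    simp only [l2CoveringNumber, Metric.externalCoveringNumber, iInf_lt_iff] at h1
    obtain ⟨C, hC, h2⟩ := h1
    exact ⟨C, hC, (ENat.lt_add_one_iff hfin).1 h2⟩
  have hCfin : C.Finite := Set.finite_of_encard_le_coe
    (k := n.toNat) (by rwa [ENat.natCast_toNat hfin])
  refine ⟨hCfin.toFinset.image fun c i => c (x i), ?_, ?_⟩
  · have h1 : (hCfin.toFinset.image fun (c : Lp ℝ 2 (empiricalMeasure x)) i => c (x i)).card
        ≤ n.toNat := by
      refine Finset.card_image_le.trans ?_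
      rw [hCfin.encard_eq_coe_toFinset_card, ← ENat.natCast_toNat hfin] at hCn
      exact_mod_cast hCn
    refine (Nat.cast_le.2 h1).trans ((Real.le_exp_log _).trans (Real.exp_le_exp.2 hlog))
  · rintro t ⟨f, hf, rfl⟩
    obtain ⟨b, hb⟩ := hbdd f hf
    have hmem : MemLp f 2 (empiricalMeasure x) :=
      MemLp.of_bound (hmeas f hf).aestronglyMeasurable b (Eventually.of_forall fun y => hb y)
    obtain ⟨c, hcC, hc⟩ := hC (show hmem.toLp f ∈ l2Classes (empiricalMeasure x) S from
      ⟨f, hf, hmem.coeFn_toLp⟩)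
    refine ⟨fun i => c (x i), Finset.mem_image.2 ⟨c, by simpa using hcC, rfl⟩, ?_⟩
    have hd : ‖hmem.toLp f - c‖ ≤ ε := by
      rw [← dist_eq_norm]
      have hc' : edist (hmem.toLp f) c ≤ ε := hc
      rw [edist_dist] at hc'
      exact ENNReal.ofReal_le_coe.1 hc'
    -- Every `x i` is an atom, so almost everywhere equalities hold there exactly and point values
    -- of a class are unambiguous.
    have hval : ∀ i, (hmem.toLp f - c : Lp ℝ 2 (empiricalMeasure x)) (x i)
        = f (x i) - c (x i) := by
      refine (ae_empiricalMeasure_iff x fun y =>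
        (hmem.toLp f - c : Lp ℝ 2 (empiricalMeasure x)) y = f y - c y).1 ?_
      filter_upwards [Lp.coeFn_sub (hmem.toLp f) c, hmem.coeFn_toLp] with y h1 h2
      rw [h1, Pi.sub_apply, h2]
    have hnorm : ‖hmem.toLp f - c‖ ^ 2
        = (Fintype.card κ : ℝ)⁻¹ * ∑ i, (f (x i) - c (x i)) ^ 2 := by
      rw [← real_inner_self_eq_norm_sq, L2.inner_def, integral_empiricalMeasure]
      congr 1
      refine Finset.sum_congr rfl fun i _ => ?_
      rw [hval]
      simp [sq]
    have h0 : (0 : ℝ) < Fintype.card κ := by exact_mod_cast Fintype.card_pos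
    have h2 : ‖hmem.toLp f - c‖ ^ 2 ≤ (ε : ℝ) ^ 2 := by gcongr
    rw [hnorm, inv_mul_le_iff₀ h0] at h2
    exact h2

/-- A class of bounded functions with a uniform entropy bound is uniformly bounded. -/
lemma HasUniformEntropy.exists_bound {S : Set (α → ℝ)} (hmeas : ∀ f ∈ S, Measurable f)
    (hbdd : ∀ f ∈ S, ∃ b, ∀ y, |f y| ≤ b) {v : ℝ} (hS : HasUniformEntropy S v) :
    ∃ B, 0 ≤ B ∧ ∀ f ∈ S, ∀ y, |f y| ≤ B := by
  classical
  obtain ⟨K, hK⟩ := hS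
  set Q : ℝ := Real.exp (K * ((1 / 2 : ℝ≥0) : ℝ) ^ (-v)) with hQ
  -- More functions than net points of radius `1 / 2`, for the pigeonhole principle below.
  set m : ℕ := ⌊Q⌋₊ + 1 with hm
  have hmQ : Q < m := by rw [hm]; exact_mod_cast Nat.lt_floor_add_one Q
  by_contra! hcon
  -- In an unbounded class of individually bounded functions one can keep adding a function and a
  -- point at which it is more than `√m` away from all earlier functions.
  obtain ⟨p, hpS, hp⟩ := exists_seq_of_forall_finset_exists
    (fun p : (α → ℝ) × α => p.1 ∈ S)
    (fun p q => √m < |q.1 q.2 - p.1 q.2|) (by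
      intro s hs
      choose! b hb using hbdd
      obtain ⟨f, hf, y, hy⟩ := hcon (∑ p ∈ s, |b p.1| + √m) (by positivity)
      refine ⟨(f, y), hf, fun p hp => ?_⟩
      have h1 : |b p.1| ≤ ∑ p ∈ s, |b p.1| :=
        Finset.single_le_sum (f := fun p : (α → ℝ) × α => |b p.1|)
          (fun _ _ => abs_nonneg _) hp
      have h2 : |p.1 y| ≤ |b p.1| := (hb p.1 (hs p hp) y).trans (le_abs_self _)
      have h3 := abs_sub_abs_le_abs_sub (f y) (p.1 y)
      show √m < |f y - p.1 y|
      linarith)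
  have : Nonempty (Fin m) := ⟨⟨0, by omega⟩⟩
  obtain ⟨s, hs, hcov⟩ := hasNet_values hmeas hbdd hK (1 / 2) (by norm_num)
    (by rw [← NNReal.coe_lt_coe]; norm_num) (fun i : Fin m => (p i).2)
  choose c hcs hc using fun i : Fin m => hcov (fun k : Fin m => (p i).1 (p k).2) ⟨_, hpS i, rfl⟩
  have hlt : s.card < (Finset.univ : Finset (Fin m)).card := by
    rw [Finset.card_univ, Fintype.card_fin]
    exact_mod_cast hs.trans_lt hmQ
  -- Under the empirical measure of the `m` chosen points, radius `1 / 2` means a squared sum of at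
  -- most `m / 4`. Two functions sharing a centre would therefore be within `√m` of each other at
  -- the point of the later one.
  have key : ∀ i j : Fin m, i < j → c i ≠ c j := by
    intro i j hij hcij
    have h1 := hc i
    have h2 := hc j
    rw [← hcij] at h2
    have h3 := (Finset.single_le_sum (f := fun k : Fin m => ((p i).1 (p k).2 - c i k) ^ 2)
      (fun _ _ => sq_nonneg _) (Finset.mem_univ j)).trans h1
    have h4 := (Finset.single_le_sum (f := fun k : Fin m => ((p j).1 (p k).2 - c i k) ^ 2)
      (fun _ _ => sq_nonneg _) (Finset.mem_univ j)).trans h2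
    have h5 := hp i j hij
    have h6 : (√m) ^ 2 < |(p j).1 (p j).2 - (p i).1 (p j).2| ^ 2 := by gcongr
    rw [Real.sq_sqrt (by positivity), sq_abs] at h6
    simp only [Fintype.card_fin] at h3 h4
    push_cast at h3 h4
    nlinarith [sq_nonneg (((p j).1 (p j).2 - c i j) + ((p i).1 (p j).2 - c i j))]
  obtain ⟨i, _, j, _, hij, hcij⟩ := Finset.exists_ne_map_eq_of_card_lt_of_maps_to hlt
    (f := c) (fun i _ => hcs i)
  rcases lt_or_gt_of_ne hij with h | h
  · exact key i j h hcij
  · exact key j i h hcij.symm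

/-- Discretizing the multiplier is free: the logarithm of the grid size is linear in `k`, hence
absorbed by the entropy growth `(2 ^ v) ^ k`. -/
lemma card_Icc_two_pow_le {v : ℝ} (hv : 0 < v) (k : ℕ) :
    ((Finset.Icc (-2 ^ k) (2 ^ k : ℤ)).card : ℝ)
      ≤ Real.exp ((2 + 1 / v) * ((2 : ℝ) ^ v) ^ k) := by
  set b : ℝ := 2 ^ v with hb
  have hb1k : 1 ≤ b ^ k := one_le_pow₀ (Real.one_le_rpow (by norm_num) hv.le)
  have hc : (Finset.Icc (-2 ^ k) (2 ^ k : ℤ)).card = 2 * 2 ^ k + 1 := by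
    rw [Int.card_Icc]
    have : (2 : ℤ) ^ k + 1 - -2 ^ k = ((2 * 2 ^ k + 1 : ℕ) : ℤ) := by push_cast; ring
    rw [this, Int.toNat_natCast]
  have hgc : ((Finset.Icc (-2 ^ k) (2 ^ k : ℤ)).card : ℝ) ≤ 3 * 2 ^ k := by
    have : (1 : ℝ) ≤ 2 ^ k := one_le_pow₀ (by norm_num)
    rw [hc]; push_cast; linarith
  have h3 : (3 : ℝ) ≤ Real.exp (2 * b ^ k) := by
    have := Real.add_one_le_exp (2 * b ^ k)
    linarith
  have h4 : (2 : ℝ) ^ k ≤ Real.exp (1 / v * b ^ k) := by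
    have h5 : b ^ k = Real.exp (v * (Real.log 2 * k)) := by
      rw [hb, ← Real.rpow_natCast, ← Real.rpow_mul (by norm_num),
        Real.rpow_def_of_pos (by norm_num)]
      ring_nf
    have h6 := Real.add_one_le_exp (v * (Real.log 2 * k))
    rw [← h5] at h6
    rw [← Real.rpow_natCast, Real.rpow_def_of_pos (by norm_num)]
    refine Real.exp_le_exp.2 ?_
    rw [one_div, ← div_eq_inv_mul, le_div_iff₀ hv]
    linarith
  rw [add_mul, Real.exp_add]
  exact hgc.trans (mul_le_mul h3 h4 (by positivity) (by positivity))

lemma exists_grid_approx {A a : ℝ} (hA : 0 < A) (ha : |a| ≤ A) (k : ℕ) :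
    ∃ z ∈ Finset.Icc (-2 ^ k) (2 ^ k : ℤ),
      |A * z / 2 ^ k| ≤ A ∧ |a - A * z / 2 ^ k| ≤ A / 2 ^ k := by
  have h2k : (0 : ℝ) < 2 ^ k := by positivity
  have haA : |a / A| ≤ 1 := by
    rw [abs_div, abs_of_pos hA, div_le_one hA]; exact ha
  obtain ⟨haA1, haA2⟩ := abs_le.1 haA
  set z : ℤ := ⌊a / A * 2 ^ k⌋ with hz
  have hzl : -2 ^ k ≤ z := by
    rw [hz, Int.le_floor]
    push_cast
    nlinarith
  have hzu : z ≤ 2 ^ k := by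
    have : (⌊a / A * 2 ^ k⌋ : ℝ) ≤ 2 ^ k := (Int.floor_le _).trans (by nlinarith)
    rw [← hz] at this
    exact_mod_cast this
  refine ⟨z, Finset.mem_Icc.2 ⟨hzl, hzu⟩, ?_, ?_⟩
  · have hzb : |(z : ℝ)| ≤ 2 ^ k := by exact_mod_cast abs_le.2 ⟨hzl, hzu⟩
    rw [abs_div, abs_mul, abs_of_pos hA, abs_of_pos h2k, div_le_iff₀ h2k]
    gcongr
  · have h1 := Int.floor_le (a / A * 2 ^ k)
    have h2 := Int.lt_floor_add_one (a / A * 2 ^ k)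
    rw [← hz] at h1 h2
    have e : a - A * z / 2 ^ k = A / 2 ^ k * (a / A * 2 ^ k - z) := by field_simp
    rw [e, abs_mul, abs_of_pos (by positivity : 0 < A / 2 ^ k)]
    exact mul_le_of_le_one_right (by positivity) (abs_le.2 ⟨by linarith, by linarith⟩)

/-- Multiples `a • f` with `|a| ≤ A` of a class with a uniform entropy bound: Rademacher averages
of a selection, after Lipschitz transformations of the values. -/
lemma exists_rademacher_bound {S : Set (α → ℝ)} (hmeas : ∀ f ∈ S, Measurable f)
    (hbdd : ∀ f ∈ S, ∃ b, ∀ y, |f y| ≤ b) {v : ℝ} (hv : 0 < v) (hv2 : v < 2)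
    (hS : HasUniformEntropy S v) :
    ∃ C : ℝ, 0 ≤ C ∧ ∀ (n : ℕ) (J : Finset (Fin n)) (x : Fin n → α) (φ : Fin n → ℝ → ℝ)
      (s A : ℝ) (a : (Fin n → Bool) → ℝ) (f : (Fin n → Bool) → α → ℝ), J.Nonempty → 0 < s → 0 < A →
      (∀ i ∈ J, ∀ t t', |φ i t - φ i t'| ≤ s * |t - t'|) → (∀ σ, |a σ| ≤ A) → (∀ σ, f σ ∈ S) →
      ∑ σ : Fin n → Bool, ∑ i ∈ J, boolSign (σ i) * φ i (a σ * f σ (x i))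
        ≤ 2 ^ n * (C * (s * A) * √J.card) := by
  classical
  obtain ⟨B, hB0, hB⟩ := hS.exists_bound hmeas hbdd
  obtain ⟨K, hK⟩ := hS
  set b : ℝ := 2 ^ v with hb
  have hb1 : 1 ≤ b := Real.one_le_rpow (by norm_num) hv.le
  have hb4 : b < 4 := by
    have : b < 2 ^ (2 : ℝ) := Real.rpow_lt_rpow_of_exponent_lt (by norm_num) hv2
    norm_num at this
    exact this
  set K' : ℝ := 2 + 1 / v + |K| with hK'
  have hK'0 : 0 < K' := by positivity
  have hq1 : √b / 2 < 1 := by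
    have : √b < 2 := (Real.sqrt_lt' (by norm_num)).2 (by linarith)
    linarith
  set G : ℝ := 1 + 8 * √K' / (1 - √b / 2) with hG
  have hG0 : 0 ≤ G := by
    have : 0 < 1 - √b / 2 := by linarith
    positivity
  refine ⟨2 * (1 + B) * G, by positivity, ?_⟩
  intro n J x φ s A a f hJ hs hA hφ ha hf
  have hJc : 0 < J.card := hJ.card_pos
  have hJc' : (0 : ℝ) < J.card := by exact_mod_cast hJc
  have : Nonempty J := hJ.to_subtype
  -- Chaining is applied to the transformed values, so the Lipschitz property enters through the
  -- nets and no contraction principle is needed.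
  set y : ℝ → (Fin n → ℝ) → Fin n → ℝ := fun a w i => if i ∈ J then φ i (a * w i) else 0 with hy
  -- The factor `2 * (1 + B)` dominates both the radius `B` around the zero rule and, at finer
  -- scales, `√(2 * B ^ 2 + 2)` from rounding the multiplier and the function together.
  set D : ℝ := s * A * (2 * (1 + B)) with hD
  have hD0 : 0 < D := by positivity
  have hdiff : ∀ a a' : ℝ, ∀ w w' : Fin n → ℝ, ∑ i, (y a w i - y a' w' i) ^ 2
      ≤ s ^ 2 * ∑ i ∈ J, (a * w i - a' * w' i) ^ 2 := by
    intro a a' w w'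
    rw [Finset.mul_sum, ← Finset.sum_filter_add_sum_filter_not Finset.univ (· ∈ J)]
    have h1 : ∑ i with i ∉ J, (y a w i - y a' w' i) ^ 2 = 0 :=
      Finset.sum_eq_zero fun i hi => by simp [hy, (Finset.mem_filter.1 hi).2]
    rw [h1, add_zero, Finset.filter_univ_mem]
    refine Finset.sum_le_sum fun i hi => ?_
    simp only [hy, hi, if_true]
    rw [← sq_abs, ← sq_abs (a * w i - _), ← mul_pow]
    exact pow_le_pow_left₀ (abs_nonneg _) (hφ i hi _ _) 2
  have main := sum_boolSign_chaining
    {t : Fin n → ℝ | ∃ a : ℝ, |a| ≤ A ∧ ∃ f ∈ S, t = y a fun i => f (x i)}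
    (fun σ => y (a σ) fun i => f σ (x i)) (fun σ => ⟨a σ, ha σ, f σ, hf σ, rfl⟩)
    (D := D) (W := J.card) (K := K') (b := b) hD0 hJc' hK'0 hb1 hb4 (y 0 0) ?_ ?_
  · have e : ∑ σ : Fin n → Bool, ∑ i ∈ J, boolSign (σ i) * φ i (a σ * f σ (x i))
        = ∑ σ : Fin n → Bool, ∑ i, boolSign (σ i) * y (a σ) (fun i => f σ (x i)) i := by
      refine Finset.sum_congr rfl fun σ _ => ?_
      simp [hy]
    rw [e]
    refine main.trans_eq ?_
    rw [Fintype.card_fin, hD, ← hG]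
    ring
  · rintro t ⟨a, ha, f, hf, rfl⟩
    refine (hdiff _ _ _ _).trans ?_
    have h1 : ∀ i ∈ J, (a * f (x i) - 0 * (0 : Fin n → ℝ) i) ^ 2 ≤ (A * B) ^ 2 := by
      intro i _
      rw [zero_mul, sub_zero, ← sq_abs, abs_mul]
      have := hB f hf (x i)
      gcongr
    have h2 := Finset.sum_le_sum h1
    rw [Finset.sum_const, nsmul_eq_mul] at h2
    calc s ^ 2 * ∑ i ∈ J, (a * f (x i) - 0 * (0 : Fin n → ℝ) i) ^ 2
        ≤ s ^ 2 * (J.card * (A * B) ^ 2) := by gcongr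
      _ = (s * A * B) ^ 2 * J.card := by ring
      _ ≤ D ^ 2 * J.card := by
        rw [hD]
        gcongr
        linarith
  · intro k
    have h2k : (1 : ℝ) < 2 ^ (k + 1) := one_lt_pow₀ (by norm_num) (by omega)
    set ε : ℝ≥0 := 1 / 2 ^ (k + 1) with hε
    have hεr : (ε : ℝ) = 1 / 2 ^ (k + 1) := by simp [hε]
    have hε0 : (0 : ℝ) < ε := by rw [hεr]; positivity
    have hε1 : (ε : ℝ) < 1 := by rw [hεr, div_lt_one (by positivity)]; exact h2k
    obtain ⟨F, hF, hFcov⟩ := hasNet_values hmeas hbdd hK ε (by exact_mod_cast hε0)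
      (by exact_mod_cast hε1) (fun i : J => x i)
    set grid : Finset ℤ := Finset.Icc (-2 ^ (k + 1)) (2 ^ (k + 1)) with hgrid
    set ext : (J → ℝ) → Fin n → ℝ := fun w i => if h : i ∈ J then w ⟨i, h⟩ else 0 with hext
    have hεv : (ε : ℝ) ^ (-v) = b ^ (k + 1) := by
      rw [hεr, one_div, Real.inv_rpow (by positivity), Real.rpow_neg (by positivity), inv_inv, hb,
        ← Real.rpow_natCast, ← Real.rpow_natCast, ← Real.rpow_mul (by norm_num),
        ← Real.rpow_mul (by norm_num), mul_comm]
    refine ⟨(grid ×ˢ F).image fun p => y (A * p.1 / 2 ^ (k + 1)) (ext p.2), ?_, ?_⟩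
    · have hc1 : (((grid ×ˢ F).image fun p => y (A * p.1 / 2 ^ (k + 1)) (ext p.2)).card : ℝ)
          ≤ grid.card * F.card := by
        rw [← Nat.cast_mul, ← Finset.card_product]
        exact_mod_cast Finset.card_image_le
      have h7 : (F.card : ℝ) ≤ Real.exp (|K| * b ^ (k + 1)) := by
        refine hF.trans (Real.exp_le_exp.2 ?_)
        rw [hεv]
        exact mul_le_mul_of_nonneg_right (le_abs_self K) (by positivity)
      calc _ ≤ (grid.card : ℝ) * F.card := hc1
        _ ≤ (Real.exp (2 * b ^ (k + 1)) * Real.exp (1 / v * b ^ (k + 1)))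
            * Real.exp (|K| * b ^ (k + 1)) := by
          rw [← Real.exp_add, ← add_mul]
          exact mul_le_mul (card_Icc_two_pow_le hv (k + 1)) h7 (by positivity) (by positivity)
        _ = Real.exp (K' * b ^ (k + 1)) := by
          rw [← Real.exp_add, ← Real.exp_add, hK']; ring_nf
    · rintro t ⟨a, ha, f, hf, rfl⟩
      obtain ⟨w, hwF, hw⟩ := hFcov (fun i : J => f (x i)) ⟨f, hf, rfl⟩
      obtain ⟨z, hzg, ha'A, haa'⟩ := exists_grid_approx hA ha (k + 1)
      refine ⟨_, Finset.mem_image.2 ⟨(z, w), Finset.mem_product.2 ⟨hzg, hwF⟩, rfl⟩, ?_⟩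
      refine (hdiff _ _ _ _).trans ?_
      set a' : ℝ := A * z / 2 ^ (k + 1) with ha'
      rw [div_eq_mul_one_div, ← hεr] at haa'
      have hterm : ∀ i ∈ J, (a * f (x i) - a' * ext w i) ^ 2
          ≤ 2 * (A * ε * B) ^ 2 + 2 * A ^ 2 * (f (x i) - ext w i) ^ 2 := by
        intro i _
        have e : a * f (x i) - a' * ext w i = (a - a') * f (x i) + a' * (f (x i) - ext w i) := by
          ring
        have h1 : ((a - a') * f (x i)) ^ 2 ≤ (A * ε * B) ^ 2 := by
          rw [← sq_abs, abs_mul]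
          have := hB f hf (x i)
          gcongr
        have h2 : (a' * (f (x i) - ext w i)) ^ 2 ≤ A ^ 2 * (f (x i) - ext w i) ^ 2 := by
          rw [mul_pow]
          refine mul_le_mul_of_nonneg_right ?_ (sq_nonneg _)
          rw [← sq_abs]
          gcongr
        rw [e]
        nlinarith [sq_nonneg ((a - a') * f (x i) - a' * (f (x i) - ext w i))]
      have hwsum : ∑ i ∈ J, (f (x i) - ext w i) ^ 2 ≤ J.card * (ε : ℝ) ^ 2 := by
        rw [← Finset.sum_coe_sort]
        simpa [hext] using hw
      have hsum := Finset.sum_le_sum hterm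
      rw [Finset.sum_add_distrib, Finset.sum_const, nsmul_eq_mul, ← Finset.mul_sum] at hsum
      have hDε : D / 2 ^ (k + 1) = D * ε := by rw [hεr]; ring
      rw [hDε]
      calc s ^ 2 * ∑ i ∈ J, (a * f (x i) - a' * ext w i) ^ 2
          ≤ s ^ 2 * (J.card * (2 * (A * ε * B) ^ 2) + 2 * A ^ 2 * (J.card * (ε : ℝ) ^ 2)) := by
            refine mul_le_mul_of_nonneg_left (hsum.trans ?_) (sq_nonneg _)
            gcongr
        _ = (s * A * ε) ^ 2 * J.card * (2 * B ^ 2 + 2) := by ring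
        _ ≤ (s * A * ε) ^ 2 * J.card * (2 * (1 + B)) ^ 2 := by
            refine mul_le_mul_of_nonneg_left ?_ (by positivity)
            nlinarith
        _ = (D * ε) ^ 2 * J.card := by rw [hD]; ring

end Entropy

/-! ### The weighted hinge loss: bounds, stability in the endpoints, relation to the surrogate loss.
-/

/-- The weighted hinge loss of the prediction value `t` for an interval with endpoints `l`, `u`. -/
noncomputable def hingeTerm (l u t : ℝ) : ℝ := weight l u * pos (1 + label l u * t)

lemma pos_nonneg (t : ℝ) : 0 ≤ pos t := le_max_right _ _

lemma abs_pos_sub_pos_le (s t : ℝ) : |pos s - pos t| ≤ |s - t| := by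
  simpa [pos] using abs_max_sub_max_le_abs s t 0

lemma abs_label_le (l u : ℝ) : |label l u| ≤ 1 := by
  simp only [label, sgn, Set.mem_Icc]
  split_ifs <;> norm_num <;> grind

lemma weight_nonneg (l u : ℝ) : 0 ≤ weight l u := by
  simp only [weight]
  positivity

lemma weight_le (l u : ℝ) : weight l u ≤ |l| + |u| := by
  have h1 := abs_nonneg l
  have h2 := abs_nonneg u
  have h3 := abs_sub_abs_le_abs_sub u l
  have h4 : |(|u| - |l|)| ≤ |l| + |u| := by
    rw [abs_le]; constructor <;> linarith
  simp only [weight, Set.mem_Icc]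
  split_ifs <;> grind

lemma pos_le (t e : ℝ) (he : |e| ≤ 1) : pos (1 + e * t) ≤ 1 + |t| := by
  have h1 : |e * t| ≤ |t| := by
    rw [abs_mul]; exact mul_le_of_le_one_left (abs_nonneg _) he
  exact max_le (by linarith [le_abs_self (e * t)]) (by positivity)

lemma hingeTerm_nonneg (l u t : ℝ) : 0 ≤ hingeTerm l u t :=
  mul_nonneg (weight_nonneg _ _) (pos_nonneg _)

lemma hingeTerm_le (l u t : ℝ) : hingeTerm l u t ≤ (|l| + |u|) * (1 + |t|) :=
  mul_le_mul (weight_le _ _) (pos_le _ _ (abs_label_le _ _)) (pos_nonneg _) (by positivity)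

lemma abs_hingeTerm_sub_le (l u t t' : ℝ) :
    |hingeTerm l u t - hingeTerm l u t'| ≤ (|l| + |u|) * |t - t'| := by
  rw [hingeTerm, hingeTerm, ← mul_sub, abs_mul, abs_of_nonneg (weight_nonneg _ _)]
  refine mul_le_mul (weight_le _ _) ((abs_pos_sub_pos_le _ _).trans ?_) (abs_nonneg _)
    (by positivity)
  rw [add_sub_add_left_eq_sub, ← mul_sub, abs_mul]
  exact mul_le_of_le_one_left (abs_nonneg _) (abs_label_le _ _)

/-- The signed weight `weight * label` of an interval with `l ≤ u`. -/
noncomputable def signedWeight (l u : ℝ) : ℝ := -(max u 0 + min l 0)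

lemma abs_signedWeight_sub_le (l u l' u' : ℝ) :
    |signedWeight l u - signedWeight l' u'| ≤ |l - l'| + |u - u'| := by
  have h1 := abs_max_sub_max_le_abs u u' 0
  have h2 := abs_min_sub_min_le_max l 0 l' 0
  simp only [sub_self, abs_zero, abs_nonneg, max_eq_left] at h2
  have e : signedWeight l u - signedWeight l' u'
      = -(max u 0 - max u' 0) + -(min l 0 - min l' 0) := by
    simp only [signedWeight]; ring
  rw [e]
  refine (abs_add_le _ _).trans ?_
  rw [abs_neg, abs_neg]
  linarith

lemma mul_pos_eq {w : ℝ} (hw : 0 ≤ w) (x : ℝ) : w * pos x = pos (w * x) := by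
  rw [pos, pos, mul_max_of_nonneg _ _ hw, mul_zero]

/-- The label jumps, but its product with the weight is continuous in the endpoints, and the weight
is the absolute value of that product. Crossed endpoints around zero are excluded because both outer
indicators then fire and the label vanishes while the weight does not. -/
lemma hingeTerm_eq {l u : ℝ} (h : ¬ (0 < l ∧ u < 0)) (t : ℝ) :
    hingeTerm l u t = pos (|signedWeight l u| + signedWeight l u * t) := by
  have hw : weight l u = |signedWeight l u| ∧ weight l u * label l u = signedWeight l u := by
    simp only [weight, label, signedWeight, sgn, Set.mem_Icc]
    rcases lt_trichotomy l 0 with hl | hl | hl <;> rcases lt_trichotomy u 0 with hu | hu | hu <;>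
      first
        | (exfalso; exact h ⟨hl, hu⟩)
        | (simp [hl, hu, hl.le, hu.le, hl.not_gt, hu.not_gt, hl.not_ge, hu.not_ge, abs_of_pos,
            abs_of_neg]; done)
        | grind
  rw [hingeTerm, mul_pos_eq (weight_nonneg _ _), mul_add, mul_one, ← mul_assoc, hw.2, hw.1]

lemma abs_pos_add_mul_sub_le (s s' t : ℝ) :
    |pos (|s| + s * t) - pos (|s'| + s' * t)| ≤ (1 + |t|) * |s - s'| := by
  refine (abs_pos_sub_pos_le _ _).trans ?_
  have e : |s| + s * t - (|s'| + s' * t) = (|s| - |s'|) + (s - s') * t := by ring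
  rw [e]
  refine (abs_add_le _ _).trans ?_
  rw [abs_mul]
  have := abs_abs_sub_abs_le_abs_sub s s'
  linarith [mul_comm |t| |s - s'|]

/-- Stability of the weighted hinge loss in the endpoints, around a genuine interval. -/
lemma abs_hingeTerm_sub_hingeTerm_le {l u l' u' : ℝ} (h' : l' ≤ u') (t : ℝ) :
    |hingeTerm l u t - hingeTerm l' u' t| ≤ 2 * (1 + |t|) * (|l - l'| + |u - u'|) := by
  have hn' : ¬ (0 < l' ∧ u' < 0) := fun h => by linarith [h.1, h.2]
  have ht : 0 ≤ |t| := abs_nonneg t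
  have hδ : 0 ≤ |l - l'| + |u - u'| := by positivity
  by_cases h : 0 < l ∧ u < 0
  -- Estimated endpoints may cross, whereas `l' ≤ u'`. The width `l - u` of the crossing is then at
  -- most the estimation error, and each loss is separately of that order.
  · have hlu : |l| + |u| ≤ |l - l'| + |u - u'| := by
      rw [abs_of_pos h.1, abs_of_neg h.2]
      linarith [le_abs_self (l - l'), neg_abs_le (u - u')]
    have h1 := (hingeTerm_le l u t).trans (mul_le_mul_of_nonneg_right hlu (by positivity))
    have hs : |signedWeight l' u'| ≤ |l - l'| + |u - u'| := by
      have := abs_signedWeight_sub_le l' u' l u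
      have e : signedWeight l u = 0 := by
        simp [signedWeight, h.1.le, h.2.le]
      rwa [e, sub_zero, abs_sub_comm l', abs_sub_comm u'] at this
    have h2 := abs_pos_add_mul_sub_le (signedWeight l' u') 0 t
    rw [← hingeTerm_eq hn'] at h2
    simp only [abs_zero, zero_mul, add_zero, sub_zero, pos, max_self] at h2
    rw [abs_of_nonneg (hingeTerm_nonneg _ _ _)] at h2
    have h3 := hingeTerm_nonneg l u t
    have h4 := hingeTerm_nonneg l' u' t
    have h5 := h2.trans (mul_le_mul_of_nonneg_left hs (by positivity))
    rw [abs_le]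
    constructor <;> nlinarith
  · rw [hingeTerm_eq h, hingeTerm_eq hn']
    refine (abs_pos_add_mul_sub_le _ _ t).trans ?_
    have h1 := abs_signedWeight_sub_le l u l' u'
    have := mul_le_mul_of_nonneg_left h1 (by positivity : 0 ≤ 1 + |t|)
    nlinarith

/-- For an interval containing zero the lift is the smaller of `|l|` and `|u|`; it does not involve
the prediction and cancels. -/
lemma surrogateLoss_sub_eq {l u : ℝ} (h : l ≤ u) (t t' : ℝ) :
    surrogateLoss l u t - surrogateLoss l u t' = hingeTerm l u t - hingeTerm l u t' := by
  simp only [surrogateLoss, hingeTerm, weight, label, sgn, Set.mem_Icc]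
  by_cases hl : 0 < l
  · have hu : ¬ u < 0 := by linarith
    simp [hl, hu, hl.not_ge, sub_eq_add_neg]
  by_cases hu : u < 0
  · simp [hl, hu, hu.not_ge]
  have hl' : l ≤ 0 := not_lt.1 hl
  have hu' : 0 ≤ u := not_lt.1 hu
  by_cases hlu : |l| ≤ |u|
  · have h1 : 0 ≤ |u| - |l| := sub_nonneg.2 hlu
    have h2 : |(|u| - |l|)| = |u| - |l| := abs_of_nonneg h1
    simp only [hl, hu, hl', hu', hlu, h1, h2, if_false, if_true, and_self]
    ring_nf
  · have h1 : ¬ (0 ≤ |u| - |l|) := by linarith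
    have h2 : |(|u| - |l|)| = |l| - |u| := by rw [abs_of_neg (not_le.1 h1)]; ring
    simp only [hl, hu, hl', hu', hlu, h1, h2, if_false, if_true, and_self]
    ring_nf

lemma surrogateLoss_nonneg (l u t : ℝ) : 0 ≤ surrogateLoss l u t := by
  have h1 := pos_nonneg (1 - t)
  have h2 := pos_nonneg (1 + t)
  simp only [surrogateLoss]
  split_ifs with _ _ h
  · positivity
  · positivity
  · have := sub_nonneg.2 h; positivity
  · have := sub_nonneg.2 (le_of_not_ge h); positivity

lemma surrogateLoss_le (l u t : ℝ) : surrogateLoss l u t ≤ (|l| + |u|) * (1 + |t|) := by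
  have h1 : pos (1 - t) ≤ 1 + |t| := by simpa [sub_eq_add_neg] using pos_le t (-1) (by simp)
  have h2 : pos (1 + t) ≤ 1 + |t| := by simpa using pos_le t 1 (by simp)
  have hl := abs_nonneg l
  have hu := abs_nonneg u
  have ht := abs_nonneg t
  have h3 : ∀ {p q x : ℝ}, 0 ≤ p → p ≤ q → x ≤ 1 + |t| → p + (q - p) * x ≤ (p + q) * (1 + |t|) := by
    intro p q x hp hpq hx
    have := mul_le_mul_of_nonneg_left hx (sub_nonneg.2 hpq)
    nlinarith [mul_nonneg hp ht]
  simp only [surrogateLoss]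
  split_ifs with _ _ h
  · nlinarith [mul_le_mul_of_nonneg_left h1 hu, mul_nonneg hl ht]
  · nlinarith [mul_le_mul_of_nonneg_left h2 hl, mul_nonneg hu ht]
  · exact h3 hl h h1
  · rw [add_comm |l|]; exact h3 hu (le_of_not_ge h) h2

/-! ### Measurability of the losses. -/

section Measurability

variable {Ω : Type*} [MeasurableSpace Ω] {l u t : Ω → ℝ}

lemma measurable_pos : Measurable pos := measurable_id.max measurable_const

lemma measurable_sgn : Measurable sgn :=
  Measurable.ite measurableSet_Ici measurable_const measurable_const

lemma measurable_hingeTerm (hl : Measurable l) (hu : Measurable u) (ht : Measurable t) :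
    Measurable fun ω => hingeTerm (l ω) (u ω) (t ω) := by
  have h1 : MeasurableSet {ω | 0 < l ω} := measurableSet_lt measurable_const hl
  have h2 : MeasurableSet {ω | u ω < 0} := measurableSet_lt hu measurable_const
  have h3 : MeasurableSet {ω | (0 : ℝ) ∈ Set.Icc (l ω) (u ω)} :=
    (measurableSet_le hl measurable_const).inter (measurableSet_le measurable_const hu)
  have hd : Measurable fun ω => |u ω| - |l ω| := hu.abs.sub hl.abs
  have hw : Measurable fun ω => weight (l ω) (u ω) :=
    ((Measurable.ite h1 hu.abs measurable_const).add
      (Measurable.ite h2 hl.abs measurable_const)).add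
      (Measurable.ite h3 hd.abs measurable_const)
  have he : Measurable fun ω => label (l ω) (u ω) :=
    ((Measurable.ite h2 measurable_const measurable_const).sub
      (Measurable.ite h1 measurable_const measurable_const)).sub
      (Measurable.ite h3 (measurable_sgn.comp hd) measurable_const)
  exact hw.mul (measurable_pos.comp (measurable_const.add (he.mul ht)))

lemma measurable_surrogateLoss (hl : Measurable l) (hu : Measurable u) (ht : Measurable t) :
    Measurable fun ω => surrogateLoss (l ω) (u ω) (t ω) := by
  have hp : Measurable fun ω => pos (1 - t ω) := measurable_pos.comp (measurable_const.sub ht)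
  have hq : Measurable fun ω => pos (1 + t ω) := measurable_pos.comp (measurable_const.add ht)
  exact Measurable.ite (measurableSet_lt measurable_const hl) (hu.abs.mul hp)
    (Measurable.ite (measurableSet_lt hu measurable_const) (hl.abs.mul hq)
      (Measurable.ite (measurableSet_le hl.abs hu.abs)
        (hl.abs.add ((hu.abs.sub hl.abs).mul hp)) (hu.abs.add ((hl.abs.sub hu.abs).mul hq))))

end Measurability

/-! ### Ghost samples and symmetrization. -/

lemma integral_comp_measurePreserving {Ω Ω' : Type*} [MeasurableSpace Ω] [MeasurableSpace Ω']
    {ρ : Measure Ω} {ρ' : Measure Ω'} {T : Ω → Ω'} (hT : MeasurePreserving T ρ ρ') {h : Ω' → ℝ}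
    (hh : Measurable h) : ∫ ω, h (T ω) ∂ρ = ∫ ω, h ω ∂ρ' := by
  rw [← hT.map_eq, integral_map hT.aemeasurable hh.aestronglyMeasurable]

lemma ae_of_ae_prod_fst {Ω Ω' : Type*} [MeasurableSpace Ω] [MeasurableSpace Ω']
    {ρ : Measure Ω} {ρ' : Measure Ω'} [SFinite ρ'] [NeZero ρ'] {p : Ω → Prop}
    (h : ∀ᵐ z ∂(ρ.prod ρ'), p z.1) : ∀ᵐ ω ∂ρ, p ω := by
  filter_upwards [Measure.ae_ae_of_ae_prod h] with ω hω
  exact hω.exists.choose_spec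

/-- Exchange the coordinates marked by `b` between a sample and a ghost sample. -/
def swapMap {𝒵 : Type*} {n : ℕ} (b : Fin n → Bool) (p : (Fin n → 𝒵) × (Fin n → 𝒵)) : (Fin n → 𝒵) × (Fin n → 𝒵) :=
  (fun i => if b i then p.2 i else p.1 i, fun i => if b i then p.1 i else p.2 i)

/-- This is where sample splitting enters: what is fitted off `J` does not see swaps inside `J`. -/
lemma eq_swapMap_fst {𝒵 β : Type*} {n : ℕ} {J : Finset (Fin n)} {l : (Fin n → 𝒵) → β}
    (hl : ∀ s s' : Fin n → 𝒵, (∀ i ∉ J, s i = s' i) → l s = l s') {b : Fin n → Bool}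
    (hb : ∀ i, b i → i ∈ J) (p : (Fin n → 𝒵) × (Fin n → 𝒵)) : l (swapMap b p).1 = l p.1 := by
  refine hl _ _ fun i hi => ?_
  have : b i = false := by
    by_contra h
    exact hi (hb i (by simpa using h))
  simp [swapMap, this]

section Swap

variable {𝒵 α : Type*} [MeasurableSpace 𝒵] [MeasurableSpace α] {n : ℕ}

variable (μ : Measure 𝒵) [IsProbabilityMeasure μ]

/-- Regrouped as independent pairs, the two samples are acted on pair by pair, by `Prod.swap` or the
identity. -/
lemma measurePreserving_swapMap (b : Fin n → Bool) :
    MeasurePreserving (swapMap b)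
      ((Measure.pi fun _ : Fin n => μ).prod (Measure.pi fun _ : Fin n => μ))
      ((Measure.pi fun _ : Fin n => μ).prod (Measure.pi fun _ : Fin n => μ)) := by
  have he := measurePreserving_arrowProdEquivProdArrow 𝒵 𝒵 (Fin n) (fun _ => μ) (fun _ => μ)
  have hs : MeasurePreserving
      (fun (p : Fin n → 𝒵 × 𝒵) i => (if b i then Prod.swap else id) (p i))
      (Measure.pi fun _ => μ.prod μ) (Measure.pi fun _ => μ.prod μ) :=
    measurePreserving_pi _ _ (f := fun i => if b i then Prod.swap else id) fun i => by
      split_ifs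
      · exact Measure.measurePreserving_swap
      · exact MeasurePreserving.id _
  convert he.comp (hs.comp he.symm) using 1
  refine funext fun p => Prod.ext (funext fun i => ?_) (funext fun i => ?_)
  · by_cases h : b i <;>
      simp [swapMap, h, MeasurableEquiv.arrowProdEquivProdArrow, Equiv.arrowProdEquivProdArrow]
  · by_cases h : b i <;>
      simp [swapMap, h, MeasurableEquiv.arrowProdEquivProdArrow, Equiv.arrowProdEquivProdArrow]

/-- Any ghost observation can serve as the independent point at which the risk is evaluated. -/
lemma measurePreserving_ghost {cov : 𝒵 → α} (hcov : Measurable cov) (i : Fin n) :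
    MeasurePreserving (fun p : (Fin n → 𝒵) × (Fin n → 𝒵) => (p.1, cov (p.2 i)))
      ((Measure.pi fun _ : Fin n => μ).prod (Measure.pi fun _ : Fin n => μ))
      ((Measure.pi fun _ : Fin n => μ).prod (μ.map cov)) :=
  (MeasurePreserving.id _).prod
    ((hcov.measurePreserving μ).comp (measurePreserving_eval (fun _ : Fin n => μ) i))


variable {cov : 𝒵 → α} {J : Finset (Fin n)}

/-- A property of functions that do not use the observations in `J`, true at almost every
independent point, is true at the observations in `J`. -/
lemma ae_train_of_ae {β : Type*} {l : (Fin n → 𝒵) → β}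
    (hl : ∀ s s' : Fin n → 𝒵, (∀ i ∉ J, s i = s' i) → l s = l s') (hcov : Measurable cov)
    {Q : β → α → Prop}
    (hQ : ∀ᵐ q ∂((Measure.pi fun _ : Fin n => μ).prod (μ.map cov)), Q (l q.1) q.2) :
    ∀ᵐ s ∂(Measure.pi fun _ : Fin n => μ), ∀ i ∈ J, Q (l s) (cov (s i)) := by
  classical
  refine ae_of_ae_prod_fst (ρ' := Measure.pi fun _ : Fin n => μ) ?_
  rw [ae_all_iff]
  intro i
  by_cases hi : i ∈ J
  -- Once all of `J` is swapped, the ghost point with index `i` is the original observation, while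
  -- `l` is unchanged.
  · have h1 := ((measurePreserving_ghost μ hcov i).comp
      (measurePreserving_swapMap μ fun k => decide (k ∈ J))).quasiMeasurePreserving.ae hQ
    filter_upwards [h1] with p hp _
    simp only [Function.comp_apply] at hp
    rw [eq_swapMap_fst hl (by simp)] at hp
    simpa [swapMap, hi] using hp
  · exact Eventually.of_forall fun p h => absurd h hi

lemma ae_ghost_of_ae {β : Type*} {l : (Fin n → 𝒵) → β} (hcov : Measurable cov)
    {Q : β → α → Prop}
    (hQ : ∀ᵐ q ∂((Measure.pi fun _ : Fin n => μ).prod (μ.map cov)), Q (l q.1) q.2) :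
    ∀ᵐ p ∂((Measure.pi fun _ : Fin n => μ).prod (Measure.pi fun _ : Fin n => μ)),
      ∀ i, Q (l p.1) (cov (p.2 i)) := by
  rw [ae_all_iff]
  exact fun i => (measurePreserving_ghost μ hcov i).quasiMeasurePreserving.ae hQ

variable {l u h : (Fin n → 𝒵) → α → ℝ}

/-- For a fixed rule, the average hinge loss over the observations that were not used for the
endpoints is unbiased. -/
lemma integral_hingeTerm_eq_average (hcov : Measurable cov) (hJ : J.Nonempty)
    (hl : ∀ s s' : Fin n → 𝒵, (∀ i ∉ J, s i = s' i) → l s = l s')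
    (hu : ∀ s s' : Fin n → 𝒵, (∀ i ∉ J, s i = s' i) → u s = u s')
    (hlm : Measurable fun q : (Fin n → 𝒵) × α => l q.1 q.2)
    (hum : Measurable fun q : (Fin n → 𝒵) × α => u q.1 q.2)
    {f : α → ℝ} (hf : Measurable f) {M B : ℝ}
    (hM : ∀ᵐ q ∂((Measure.pi fun _ : Fin n => μ).prod (μ.map cov)),
      |l q.1 q.2| ≤ M ∧ |u q.1 q.2| ≤ M) (hB : ∀ x, |f x| ≤ B) :
    Integrable (fun s => (J.card : ℝ)⁻¹ * ∑ i ∈ J, hingeTerm (l s (cov (s i))) (u s (cov (s i)))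
        (f (cov (s i)))) (Measure.pi fun _ : Fin n => μ) ∧
    ∫ s, (J.card : ℝ)⁻¹ * ∑ i ∈ J, hingeTerm (l s (cov (s i))) (u s (cov (s i)))
        (f (cov (s i))) ∂(Measure.pi fun _ : Fin n => μ)
      = ∫ q, hingeTerm (l q.1 q.2) (u q.1 q.2) (f q.2)
          ∂((Measure.pi fun _ : Fin n => μ).prod (μ.map cov)) := by
  classical
  set π := Measure.pi fun _ : Fin n => μ with hπ
  set g : (Fin n → 𝒵) × α → ℝ := fun q => hingeTerm (l q.1 q.2) (u q.1 q.2) (f q.2) with hg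
  have hgm : Measurable g := measurable_hingeTerm hlm hum (hf.comp measurable_snd)
  have hgl : ∀ s s' : Fin n → 𝒵, (∀ i ∉ J, s i = s' i) → (fun x => g (s, x)) = fun x => g (s', x) :=
    fun s s' h => by simp only [hg]; rw [hl s s' h, hu s s' h]
  have hgm' : ∀ i, Measurable fun s : Fin n → 𝒵 => g (s, cov (s i)) := fun i =>
    hgm.comp (measurable_id.prodMk (hcov.comp (measurable_pi_apply i)))
  have hgb : ∀ᵐ s ∂π, ∀ i ∈ J, |g (s, cov (s i))| ≤ 2 * M * (1 + B) := by
    have := ae_train_of_ae (J := J) (l := fun s => (l s, u s)) μ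
      (fun s s' h => by rw [hl s s' h, hu s s' h]) hcov
      (Q := fun b x => |b.1 x| ≤ M ∧ |b.2 x| ≤ M) hM
    filter_upwards [this] with s hs i hi
    obtain ⟨h1, h2⟩ := hs i hi
    simp only [hg]
    rw [abs_of_nonneg (hingeTerm_nonneg _ _ _)]
    refine (hingeTerm_le _ _ _).trans ?_
    have := hB (cov (s i))
    have h0 := abs_nonneg (l s (cov (s i)))
    exact mul_le_mul (by linarith) (by linarith) (by positivity) (by linarith)
  have hint : ∀ i ∈ J, Integrable (fun s => g (s, cov (s i))) π := fun i hi =>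
    Integrable.of_bound (hgm' i).aestronglyMeasurable (2 * M * (1 + B))
      (hgb.mono fun s hs => hs i hi)
  refine ⟨(integrable_finsetSum J hint).const_mul _, ?_⟩
  have heq : ∀ i ∈ J, ∫ s, g (s, cov (s i)) ∂π = ∫ q, g q ∂(π.prod (μ.map cov)) := by
    intro i hi
    rw [← integral_comp_measurePreserving ((measurePreserving_ghost μ hcov i).comp
      (measurePreserving_swapMap μ fun k => decide (k ∈ J))) hgm,
      ← integral_comp_measurePreserving
        (measurePreserving_fst (μ := π) (ν := Measure.pi fun _ : Fin n => μ)) (hgm' i)]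
    refine integral_congr_ae (Eventually.of_forall fun p => ?_)
    have h1 := congr_fun (eq_swapMap_fst hgl (b := fun k => decide (k ∈ J)) (by simp) p)
      (cov (p.1 i))
    simp only [Function.comp_apply]
    rw [show (swapMap (fun k => decide (k ∈ J)) p).2 i = p.1 i by simp [swapMap, hi]]
    exact h1.symm
  have hJc : (J.card : ℝ) ≠ 0 := by exact_mod_cast hJ.card_pos.ne'
  change ∫ s, (J.card : ℝ)⁻¹ * ∑ i ∈ J, g (s, cov (s i)) ∂π = _
  rw [integral_const_mul, integral_finsetSum J hint, Finset.sum_congr rfl heq, Finset.sum_const,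
    nsmul_eq_mul, inv_mul_cancel_left₀ hJc]

/-- Symmetrization: the expected gap between the risk and the empirical risk of a data-dependent
rule with values in the multiples of a class for which Rademacher averages are controlled. -/
lemma integral_hingeTerm_sub_average_le (hcov : Measurable cov) (hJ : J.Nonempty)
    (hl : ∀ s s' : Fin n → 𝒵, (∀ i ∉ J, s i = s' i) → l s = l s')
    (hu : ∀ s s' : Fin n → 𝒵, (∀ i ∉ J, s i = s' i) → u s = u s')
    (hlm : Measurable fun q : (Fin n → 𝒵) × α => l q.1 q.2)
    (hum : Measurable fun q : (Fin n → 𝒵) × α => u q.1 q.2)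
    (hhm : Measurable fun q : (Fin n → 𝒵) × α => h q.1 q.2) {M B A C : ℝ} (hM0 : 0 < M)
    (hA : 0 < A)
    (hM : ∀ᵐ q ∂((Measure.pi fun _ : Fin n => μ).prod (μ.map cov)),
      |l q.1 q.2| ≤ M ∧ |u q.1 q.2| ≤ M)
    (hB : ∀ᵐ s ∂(Measure.pi fun _ : Fin n => μ), ∀ x, |h s x| ≤ B) {S : Set (α → ℝ)}
    (hS : ∀ᵐ s ∂(Measure.pi fun _ : Fin n => μ), ∃ a : ℝ, |a| ≤ A ∧ ∃ f ∈ S, ∀ x, h s x = a * f x)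
    (hC : ∀ (x : Fin n → α) (φ : Fin n → ℝ → ℝ)
      (s A : ℝ) (a : (Fin n → Bool) → ℝ) (f : (Fin n → Bool) → α → ℝ), J.Nonempty → 0 < s → 0 < A →
      (∀ i ∈ J, ∀ t t', |φ i t - φ i t'| ≤ s * |t - t'|) → (∀ σ, |a σ| ≤ A) → (∀ σ, f σ ∈ S) →
      ∑ σ : Fin n → Bool, ∑ i ∈ J, boolSign (σ i) * φ i (a σ * f σ (x i))
        ≤ 2 ^ n * (C * (s * A) * √J.card)) :
    Integrable (fun q => hingeTerm (l q.1 q.2) (u q.1 q.2) (h q.1 q.2))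
      ((Measure.pi fun _ : Fin n => μ).prod (μ.map cov)) ∧
    Integrable (fun s => (J.card : ℝ)⁻¹ * ∑ i ∈ J, hingeTerm (l s (cov (s i))) (u s (cov (s i)))
        (h s (cov (s i)))) (Measure.pi fun _ : Fin n => μ) ∧
    ∫ q, hingeTerm (l q.1 q.2) (u q.1 q.2) (h q.1 q.2)
          ∂((Measure.pi fun _ : Fin n => μ).prod (μ.map cov))
      - ∫ s, (J.card : ℝ)⁻¹ * ∑ i ∈ J, hingeTerm (l s (cov (s i))) (u s (cov (s i)))
        (h s (cov (s i))) ∂(Measure.pi fun _ : Fin n => μ)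
      ≤ 4 * C * M * A / √J.card := by
  classical
  have : IsProbabilityMeasure (μ.map cov) := Measure.isProbabilityMeasure_map hcov.aemeasurable
  set π := Measure.pi fun _ : Fin n => μ with hπ
  set g : (Fin n → 𝒵) × α → ℝ := fun q => hingeTerm (l q.1 q.2) (u q.1 q.2) (h q.1 q.2) with hg
  have hgm : Measurable g := measurable_hingeTerm hlm hum hhm
  have hgm' : ∀ i, Measurable fun s : Fin n → 𝒵 => g (s, cov (s i)) := fun i =>
    hgm.comp (measurable_id.prodMk (hcov.comp (measurable_pi_apply i)))
  have hbound : ∀ s x, |l s x| ≤ M ∧ |u s x| ≤ M → |h s x| ≤ B →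
      |g (s, x)| ≤ 2 * M * (1 + B) := by
    intro s x h12 h3
    simp only [hg]
    rw [abs_of_nonneg (hingeTerm_nonneg _ _ _)]
    refine (hingeTerm_le _ _ _).trans ?_
    exact mul_le_mul (by linarith) (by linarith) (by positivity) (by linarith)
  have htrain := ae_train_of_ae (J := J) (l := fun s => (l s, u s)) μ
      (fun s s' h => by rw [hl s s' h, hu s s' h]) hcov
      (Q := fun b x => |b.1 x| ≤ M ∧ |b.2 x| ≤ M) hM
  have hghost := ae_ghost_of_ae (l := fun s => (l s, u s)) μ hcov
      (Q := fun b x => |b.1 x| ≤ M ∧ |b.2 x| ≤ M) hM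
  have hgint : Integrable g (π.prod (μ.map cov)) := by
    refine Integrable.of_bound hgm.aestronglyMeasurable (2 * M * (1 + B)) ?_
    filter_upwards [hM, Measure.quasiMeasurePreserving_fst.ae hB] with q h1 h2
    exact hbound _ _ h1 (h2 q.2)
  have hint : ∀ i ∈ J, Integrable (fun s => g (s, cov (s i))) π := fun i hi => by
    refine Integrable.of_bound (hgm' i).aestronglyMeasurable (2 * M * (1 + B)) ?_
    filter_upwards [htrain, hB] with s h1 h2
    exact hbound _ _ (h1 i hi) (h2 _)
  have hJc : (0 : ℝ) < J.card := by exact_mod_cast hJ.card_pos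
  refine ⟨hgint, (integrable_finsetSum J hint).const_mul _, ?_⟩
  set D : (Fin n → 𝒵) × (Fin n → 𝒵) → ℝ :=
    fun p => ∑ i ∈ J, (g (p.1, cov (p.2 i)) - g (p.1, cov (p.1 i))) with hD
  have hint1 : ∀ i, Integrable (fun p : (Fin n → 𝒵) × (Fin n → 𝒵) => g (p.1, cov (p.2 i)))
      (π.prod π) := fun i =>
    (measurePreserving_ghost μ hcov i).integrable_comp_of_integrable hgint
  have hint2 : ∀ i ∈ J, Integrable (fun p : (Fin n → 𝒵) × (Fin n → 𝒵) => g (p.1, cov (p.1 i)))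
      (π.prod π) := fun i hi =>
    (measurePreserving_fst (μ := π) (ν := π)).integrable_comp_of_integrable (hint i hi)
  have hDm : Measurable D := Finset.measurable_sum _ fun i _ =>
    (hgm.comp (measurable_fst.prodMk (hcov.comp ((measurable_pi_apply i).comp measurable_snd)))).sub
      ((hgm' i).comp measurable_fst)
  have hDint : Integrable D (π.prod π) :=
    integrable_finsetSum J fun i hi => (hint1 i).sub (hint2 i hi)
  have hDval : ∫ p, D p ∂(π.prod π)
      = J.card * ∫ q, g q ∂(π.prod (μ.map cov)) - ∑ i ∈ J, ∫ s, g (s, cov (s i)) ∂π := by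
    have hsum := integral_finsetSum J fun i hi => (hint1 i).sub (hint2 i hi)
    simp only [Pi.sub_apply] at hsum
    rw [hD, hsum, ← nsmul_eq_mul, ← Finset.sum_const, ← Finset.sum_sub_distrib]
    refine Finset.sum_congr rfl fun i hi => ?_
    rw [integral_sub (hint1 i) (hint2 i hi)]
    congr 1
    · exact integral_comp_measurePreserving (measurePreserving_ghost μ hcov i) hgm
    · exact integral_comp_measurePreserving (measurePreserving_fst (μ := π) (ν := π)) (hgm' i)
  set τ : (Fin n → Bool) → (Fin n → 𝒵) × (Fin n → 𝒵) → (Fin n → 𝒵) × (Fin n → 𝒵) :=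
    fun σ => swapMap fun i => decide (i ∈ J) && σ i with hτ
  have hτmp : ∀ σ, MeasurePreserving (τ σ) (π.prod π) (π.prod π) := fun σ =>
    measurePreserving_swapMap μ _
  -- A swap exchanges the two evaluation points, hence the sign. The endpoints stay put, and the
  -- rule at both points becomes the one fitted to the swapped sample.
  have hterm : ∀ σ p, D (τ σ p) = ∑ i ∈ J, boolSign (σ i)
      * (hingeTerm (l p.1 (cov (p.2 i))) (u p.1 (cov (p.2 i))) (h (τ σ p).1 (cov (p.2 i)))
        - hingeTerm (l p.1 (cov (p.1 i))) (u p.1 (cov (p.1 i))) (h (τ σ p).1 (cov (p.1 i)))) := by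
    intro σ p
    have h1 : l (τ σ p).1 = l p.1 := eq_swapMap_fst hl (by simp; tauto) p
    have h2 : u (τ σ p).1 = u p.1 := eq_swapMap_fst hu (by simp; tauto) p
    refine Finset.sum_congr rfl fun i hi => ?_
    simp only [hg, h1, h2]
    cases hσ : σ i
    · have h3 : (τ σ p).1 i = p.1 i := by simp [hτ, swapMap, hσ]
      have h4 : (τ σ p).2 i = p.2 i := by simp [hτ, swapMap, hσ]
      rw [h3, h4]
      simp [boolSign]
    · have h3 : (τ σ p).1 i = p.2 i := by simp [hτ, swapMap, hσ, hi]
      have h4 : (τ σ p).2 i = p.1 i := by simp [hτ, swapMap, hσ, hi]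
      rw [h3, h4]
      simp [boolSign]
  have hpt : ∀ᵐ p ∂(π.prod π), ∑ σ : Fin n → Bool, D (τ σ p)
      ≤ 2 ^ n * (4 * C * M * A * √J.card) := by
    have hall : ∀ᵐ p ∂(π.prod π), ∀ σ, ∃ a : ℝ, |a| ≤ A ∧ ∃ f ∈ S,
        ∀ x, h (τ σ p).1 x = a * f x := by
      rw [ae_all_iff]
      exact fun σ => (Measure.quasiMeasurePreserving_fst.comp
        (hτmp σ).quasiMeasurePreserving).ae hS
    filter_upwards [hall, hghost, Measure.quasiMeasurePreserving_fst.ae htrain]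
      with p hp hg1 hg2
    -- With both samples fixed, the fits to the swapped samples form a selection indexed by signs.
    -- Ghost and original points are bounded separately, each with Lipschitz constant `2 * M`.
    choose a ha f hf hfa using hp
    have hlip : ∀ x : α, |l p.1 x| ≤ M ∧ |u p.1 x| ≤ M → ∀ t t' : ℝ,
        |hingeTerm (l p.1 x) (u p.1 x) t - hingeTerm (l p.1 x) (u p.1 x) t'|
          ≤ (2 * M) * |t - t'| := fun x hx t t' =>
      (abs_hingeTerm_sub_le _ _ _ _).trans
        (mul_le_mul_of_nonneg_right (by linarith) (abs_nonneg _))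
    have e1 := hC (fun i => cov (p.2 i))
      (fun i t => hingeTerm (l p.1 (cov (p.2 i))) (u p.1 (cov (p.2 i))) t) (2 * M) A a f hJ
      (by positivity) hA (fun i hi => hlip _ (hg1 i)) ha hf
    have e2 := hC (fun i => cov (p.1 i))
      (fun i t => -hingeTerm (l p.1 (cov (p.1 i))) (u p.1 (cov (p.1 i))) t) (2 * M) A a f hJ
      (by positivity) hA (fun i hi t t' => by
        rw [neg_sub_neg, abs_sub_comm]; exact hlip _ (hg2 i hi) t t') ha hf
    have e3 : ∑ σ : Fin n → Bool, D (τ σ p)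
        = (∑ σ : Fin n → Bool, ∑ i ∈ J, boolSign (σ i)
            * hingeTerm (l p.1 (cov (p.2 i))) (u p.1 (cov (p.2 i))) (a σ * f σ (cov (p.2 i))))
          + ∑ σ : Fin n → Bool, ∑ i ∈ J, boolSign (σ i)
            * -hingeTerm (l p.1 (cov (p.1 i))) (u p.1 (cov (p.1 i))) (a σ * f σ (cov (p.1 i))) := by
      rw [← Finset.sum_add_distrib]
      refine Finset.sum_congr rfl fun σ _ => ?_
      rw [hterm, ← Finset.sum_add_distrib]
      refine Finset.sum_congr rfl fun i _ => ?_
      rw [hfa, hfa]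
      ring
    rw [e3]
    refine (add_le_add e1 e2).trans_eq ?_
    ring
  have hτint : ∀ σ, Integrable (fun p => D (τ σ p)) (π.prod π) := fun σ =>
    (hτmp σ).integrable_comp_of_integrable hDint
  have hDle : ∫ p, D p ∂(π.prod π) ≤ 4 * C * M * A * √J.card := by
    have h1 : ∫ p, ∑ σ : Fin n → Bool, D (τ σ p) ∂(π.prod π)
        = 2 ^ n * ∫ p, D p ∂(π.prod π) := by
      rw [integral_finsetSum _ fun σ _ => hτint σ,
        Finset.sum_congr rfl fun σ _ => integral_comp_measurePreserving (hτmp σ) hDm]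
      simp
    have h2 := integral_mono_ae (integrable_finsetSum _ fun σ _ => hτint σ)
      (integrable_const (2 ^ n * (4 * C * M * A * √J.card))) hpt
    rw [h1] at h2
    simp only [integral_const, probReal_univ, one_smul] at h2
    exact le_of_mul_le_mul_left h2 (by positivity)
  change ∫ q, g q ∂(π.prod (μ.map cov))
    - ∫ s, (J.card : ℝ)⁻¹ * ∑ i ∈ J, g (s, cov (s i)) ∂π ≤ _
  rw [integral_const_mul, integral_finsetSum J hint]
  have h3 : J.card * (∫ q, g q ∂(π.prod (μ.map cov))
      - (J.card : ℝ)⁻¹ * ∑ i ∈ J, ∫ s, g (s, cov (s i)) ∂π) ≤ 4 * C * M * A * √J.card := by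
    rw [mul_sub, mul_inv_cancel_left₀ hJc.ne', ← hDval]
    exact hDle
  have h4 : (J.card : ℝ) * (4 * C * M * A / √J.card) = 4 * C * M * A * √J.card := by
    have h5 : 0 < √(J.card : ℝ) := Real.sqrt_pos.2 hJc
    field_simp
    rw [Real.sq_sqrt hJc.le, mul_comm]
  rw [← h4] at h3
  exact le_of_mul_le_mul_left h3 hJc

end Swap

/-! ### Oracle inequality for a fixed split. -/

section Oracle

variable {𝒵 α : Type*} [MeasurableSpace 𝒵] [MeasurableSpace α] {n : ℕ}
  (μ : Measure 𝒵) [IsProbabilityMeasure μ] {cov : 𝒵 → α} {J : Finset (Fin n)}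
  {l u h : (Fin n → 𝒵) → α → ℝ}

/-- Oracle inequality for an approximate empirical minimizer, for a fixed split of the sample. -/
lemma integral_surrogateLoss_sub_le (hcov : Measurable cov) (hJ : J.Nonempty)
    (hl : ∀ s s' : Fin n → 𝒵, (∀ i ∉ J, s i = s' i) → l s = l s')
    (hu : ∀ s s' : Fin n → 𝒵, (∀ i ∉ J, s i = s' i) → u s = u s')
    (hlm : Measurable fun q : (Fin n → 𝒵) × α => l q.1 q.2)
    (hum : Measurable fun q : (Fin n → 𝒵) × α => u q.1 q.2)
    (hhm : Measurable fun q : (Fin n → 𝒵) × α => h q.1 q.2) {M B B' A C Λ : ℝ} (hM0 : 0 < M)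
    (hA : 0 < A)
    (hM : ∀ᵐ q ∂((Measure.pi fun _ : Fin n => μ).prod (μ.map cov)),
      |l q.1 q.2| ≤ M ∧ |u q.1 q.2| ≤ M)
    (hB : ∀ᵐ s ∂(Measure.pi fun _ : Fin n => μ), ∀ x, |h s x| ≤ B) {S : Set (α → ℝ)}
    (hS : ∀ᵐ s ∂(Measure.pi fun _ : Fin n => μ), ∃ a : ℝ, |a| ≤ A ∧ ∃ f ∈ S, ∀ x, h s x = a * f x)
    (hC : ∀ (x : Fin n → α) (φ : Fin n → ℝ → ℝ)
      (s A : ℝ) (a : (Fin n → Bool) → ℝ) (f : (Fin n → Bool) → α → ℝ), J.Nonempty → 0 < s → 0 < A →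
      (∀ i ∈ J, ∀ t t', |φ i t - φ i t'| ≤ s * |t - t'|) → (∀ σ, |a σ| ≤ A) → (∀ σ, f σ ∈ S) →
      ∑ σ : Fin n → Bool, ∑ i ∈ J, boolSign (σ i) * φ i (a σ * f σ (x i))
        ≤ 2 ^ n * (C * (s * A) * √J.card))
    {L U f : α → ℝ} (hL : Measurable L) (hU : Measurable U) (hf : Measurable f)
    (hLU : ∀ᵐ x ∂(μ.map cov), L x ≤ U x) (hLUM : ∀ᵐ x ∂(μ.map cov), |L x| ≤ M ∧ |U x| ≤ M)
    (hB' : ∀ x, |f x| ≤ B')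
    (hcomp : ∀ᵐ s ∂(Measure.pi fun _ : Fin n => μ),
      (J.card : ℝ)⁻¹ * ∑ i ∈ J, hingeTerm (l s (cov (s i))) (u s (cov (s i))) (h s (cov (s i)))
      ≤ (J.card : ℝ)⁻¹ * ∑ i ∈ J, hingeTerm (l s (cov (s i))) (u s (cov (s i))) (f (cov (s i)))
        + Λ) :
    ∫ q, surrogateLoss (L q.2) (U q.2) (h q.1 q.2)
          ∂((Measure.pi fun _ : Fin n => μ).prod (μ.map cov))
      - ∫ x, surrogateLoss (L x) (U x) (f x) ∂(μ.map cov)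
      ≤ Λ + 4 * C * M * A / √J.card + 2 * (2 + B + B')
        * ∫ q, (|l q.1 q.2 - L q.2| + |u q.1 q.2 - U q.2|)
          ∂((Measure.pi fun _ : Fin n => μ).prod (μ.map cov)) := by
  have hPp : IsProbabilityMeasure (μ.map cov) := Measure.isProbabilityMeasure_map hcov.aemeasurable
  obtain ⟨hg1, hg2, hgap⟩ := integral_hingeTerm_sub_average_le μ hcov hJ hl hu hlm hum hhm hM0 hA
    hM hB hS hC
  obtain ⟨hf2, hfeq⟩ := integral_hingeTerm_eq_average μ hcov hJ hl hu hlm hum hf hM hB'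
  set P := μ.map cov with hP
  set π := Measure.pi fun _ : Fin n => μ with hπ
  have hB2 : ∀ᵐ q ∂(π.prod P), |h q.1 q.2| ≤ B :=
    (Measure.quasiMeasurePreserving_fst.ae hB).mono fun q hq => hq q.2
  have hLU2 : ∀ᵐ q ∂(π.prod P), L q.2 ≤ U q.2 := Measure.quasiMeasurePreserving_snd.ae hLU
  have hLUM2 : ∀ᵐ q ∂(π.prod P), |L q.2| ≤ M ∧ |U q.2| ≤ M :=
    Measure.quasiMeasurePreserving_snd.ae hLUM
  have hLm : Measurable fun q : (Fin n → 𝒵) × α => L q.2 := hL.comp measurable_snd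
  have hUm : Measurable fun q : (Fin n → 𝒵) × α => U q.2 := hU.comp measurable_snd
  have hfm : Measurable fun q : (Fin n → 𝒵) × α => f q.2 := hf.comp measurable_snd
  have hlossb : ∀ {l u t b : ℝ}, |l| ≤ M → |u| ≤ M → |t| ≤ b →
      ‖surrogateLoss l u t‖ ≤ 2 * M * (1 + b) := by
    intro l u t b h1 h2 h3
    rw [Real.norm_of_nonneg (surrogateLoss_nonneg _ _ _)]
    refine (surrogateLoss_le _ _ _).trans ?_
    exact mul_le_mul (by linarith) (by linarith) (by positivity) (by positivity)
  have hi1 : Integrable (fun q => surrogateLoss (L q.2) (U q.2) (h q.1 q.2)) (π.prod P) := by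
    refine Integrable.of_bound (measurable_surrogateLoss hLm hUm hhm).aestronglyMeasurable
      (2 * M * (1 + B)) ?_
    filter_upwards [hB2, hLUM2] with q h1 h2
    exact hlossb h2.1 h2.2 h1
  have hi2 : Integrable (fun q => surrogateLoss (L q.2) (U q.2) (f q.2)) (π.prod P) := by
    refine Integrable.of_bound (measurable_surrogateLoss hLm hUm hfm).aestronglyMeasurable
      (2 * M * (1 + B')) ?_
    filter_upwards [hLUM2] with q h2
    exact hlossb h2.1 h2.2 (hB' _)
  have hi3 : Integrable (fun q => hingeTerm (l q.1 q.2) (u q.1 q.2) (f q.2)) (π.prod P) := by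
    refine Integrable.of_bound (measurable_hingeTerm hlm hum hfm).aestronglyMeasurable
      (2 * M * (1 + B')) ?_
    filter_upwards [hM] with q h2
    rw [Real.norm_of_nonneg (hingeTerm_nonneg _ _ _)]
    refine (hingeTerm_le _ _ _).trans ?_
    exact mul_le_mul (by linarith) (by linarith [hB' q.2]) (by positivity) (by positivity)
  have hi4 : Integrable (fun q => |l q.1 q.2 - L q.2| + |u q.1 q.2 - U q.2|) (π.prod P) := by
    refine Integrable.of_bound
      ((hlm.sub hLm).abs.add (hum.sub hUm).abs).aestronglyMeasurable (4 * M) ?_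
    filter_upwards [hM, hLUM2] with q h1 h2
    rw [Real.norm_of_nonneg (by positivity)]
    have h3 := abs_sub (l q.1 q.2) (L q.2)
    have h4 := abs_sub (u q.1 q.2) (U q.2)
    linarith [h1.1, h1.2, h2.1, h2.2]
  have hfs : ∫ x, surrogateLoss (L x) (U x) (f x) ∂P
      = ∫ q, surrogateLoss (L q.2) (U q.2) (f q.2) ∂(π.prod P) :=
    (integral_comp_measurePreserving (measurePreserving_snd (μ := π) (ν := P))
      (measurable_surrogateLoss hL hU hf)).symm
  -- The endpoints are replaced once for `h` and once for `f`, which gives `2 * (1 + B) + 2 * (1 +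
  -- B')`.
  have hpt : ∫ q, (surrogateLoss (L q.2) (U q.2) (h q.1 q.2)
        - surrogateLoss (L q.2) (U q.2) (f q.2)) ∂(π.prod P)
      ≤ ∫ q, (hingeTerm (l q.1 q.2) (u q.1 q.2) (h q.1 q.2)
        - hingeTerm (l q.1 q.2) (u q.1 q.2) (f q.2)
        + 2 * (2 + B + B') * (|l q.1 q.2 - L q.2| + |u q.1 q.2 - U q.2|)) ∂(π.prod P) := by
    refine integral_mono_ae (hi1.sub hi2) ((hg1.sub hi3).add (hi4.const_mul _)) ?_
    filter_upwards [hLU2, hB2] with q h1 h2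
    have h3 := hB' q.2
    have h0 : 0 ≤ |l q.1 q.2 - L q.2| + |u q.1 q.2 - U q.2| := by positivity
    have h4 := (abs_hingeTerm_sub_hingeTerm_le (l := l q.1 q.2) (u := u q.1 q.2) h1
      (h q.1 q.2)).trans (mul_le_mul_of_nonneg_right (by linarith : _ ≤ 2 * (1 + B)) h0)
    have h5 := (abs_hingeTerm_sub_hingeTerm_le (l := l q.1 q.2) (u := u q.1 q.2) h1
      (f q.2)).trans (mul_le_mul_of_nonneg_right (by linarith : _ ≤ 2 * (1 + B')) h0)
    have h6 := surrogateLoss_sub_eq h1 (h q.1 q.2) (f q.2)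
    have h7 := (abs_le.1 h4).1
    have h8 := (abs_le.1 h5).2
    rw [h6]
    linarith
  rw [integral_sub hi1 hi2, ← hfs] at hpt
  refine hpt.trans ?_
  have hadd := integral_add (hg1.sub hi3) (hi4.const_mul (2 * (2 + B + B')))
  simp only [Pi.sub_apply] at hadd
  rw [hadd, integral_sub hg1 hi3, integral_const_mul, ← hfeq]
  have hc := integral_mono_ae hg2 (hf2.add (integrable_const Λ)) hcomp
  have hadd2 := integral_add hf2 (integrable_const (μ := π) Λ)
  simp only [integral_const, probReal_univ, one_smul] at hadd2
  simp only [Pi.add_apply] at hc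
  rw [hadd2] at hc
  linarith

end Oracle

/-! ### A priori bound on the estimator, and the rate. -/

/-- Comparison with the zero function bounds a penalized empirical risk minimizer. -/
lemma abs_le_of_isMinOn_empiricalObjective {d : ℕ} {𝒳 : Set (Fin d → ℝ)}
    {H : Submodule ℝ (↥𝒳 → ℝ)} {N : Seminorm ℝ H} {n : ℕ} {I : Finset (Fin n)} {l u : ↥𝒳 → ℝ}
    {lam M M₄ : ℝ} {s : Fin n → Obs 𝒳} {F : Set H} {f : H} (hlam : 0 < lam) (hM : 0 ≤ M)
    (hM₄ : 0 < M₄) (h0 : (0 : H) ∈ F)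
    (hmin : IsMinOn (empiricalObjective N I l u lam s) F f)
    (hb : ∀ i ∈ I, |l (s i).cov| ≤ M ∧ |u (s i).cov| ≤ M)
    (hnorm : ∀ x, M₄ * |(f : ↥𝒳 → ℝ) x| ≤ N f) (x : ↥𝒳) :
    |(f : ↥𝒳 → ℝ) x| ≤ √(4 * M / lam) / M₄ := by
  have h1 : empiricalObjective N I l u lam s f ≤ empiricalObjective N I l u lam s 0 :=
    hmin h0
  have h2 : lam / 2 * N f ^ 2 ≤ empiricalObjective N I l u lam s f := by
    refine le_add_of_nonneg_left (mul_nonneg (by positivity) (Finset.sum_nonneg fun i _ => ?_))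
    exact hingeTerm_nonneg _ _ _
  have h3 : empiricalObjective N I l u lam s 0 ≤ 2 * M := by
    have e : empiricalObjective N I l u lam s 0
        = (I.card : ℝ)⁻¹ * ∑ i ∈ I, hingeTerm (l (s i).cov) (u (s i).cov) 0 := by
      simp [empiricalObjective, hingeTerm]
    have hs : ∑ i ∈ I, hingeTerm (l (s i).cov) (u (s i).cov) 0 ≤ I.card * (2 * M) := by
      rw [← nsmul_eq_mul]
      refine Finset.sum_le_card_nsmul _ _ _ fun i hi => (hingeTerm_le _ _ _).trans ?_
      have := hb i hi
      simp only [abs_zero, add_zero, mul_one]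
      linarith
    rw [e]
    rcases I.eq_empty_or_nonempty with rfl | hI
    · simpa using hM
    · have : (0 : ℝ) < I.card := by exact_mod_cast hI.card_pos
      rwa [inv_mul_le_iff₀ this]
  have h4 : N f ^ 2 ≤ 4 * M / lam := by
    rw [le_div_iff₀ hlam]
    linarith
  rw [le_div_iff₀ hM₄, mul_comm]
  exact (hnorm x).trans (Real.le_sqrt_of_sq_le h4)

/-- The three error terms match the three rate terms. As `lam ≤ 1`, the power `lam ^ (-1/2)` is at
least 1 and absorbs the bounded part of the third factor; the extra cross products on the right are
nonnegative. -/
lemma oracle_rate_le {m lam c M M₄ B' C C₀ r kα kβ a b Iα Iβ : ℝ} (hm : 0 < m) (hlam : 0 < lam)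
    (hlam1 : lam ≤ 1) (hc : 0 < c) (hM : 0 ≤ M) (hM₄ : 0 < M₄) (hB' : 0 ≤ B') (hC : 0 ≤ C)
    (hC₀ : 0 ≤ C₀) (hkα : 0 ≤ kα) (hkβ : 0 ≤ kβ) (ha : 0 ≤ a) (hb : 0 ≤ b) (hIα : 0 ≤ Iα)
    (hIβ : 0 ≤ Iβ) (hα : Iα ≤ kα * a) (hβ : Iβ ≤ kβ * b) :
    lam / 2 * r ^ 2 + 4 * C * M * (C₀ * lam⁻¹) / √(c * m)
        + 2 * (2 + √(4 * M / lam) / M₄ + B') * (Iα + Iβ)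
      ≤ (r ^ 2 / 2 + 4 * C * M * C₀ / √c + 2 * (2 + 2 * √M / M₄ + B') * (kα + kβ))
        * (lam + m ^ (-(1 / 2) : ℝ) * lam⁻¹ + lam ^ (-(1 / 2) : ℝ) * (a + b)) := by
  have hrpow : ∀ x : ℝ, 0 ≤ x → x ^ (-(1 / 2) : ℝ) = 1 / √x := fun x hx => by
    rw [Real.rpow_neg hx, ← Real.sqrt_eq_rpow, one_div]
  set c₁ : ℝ := r ^ 2 / 2 with hc₁
  set c₂ : ℝ := 4 * C * M * C₀ / √c with hc₂
  set c₃ : ℝ := 2 * (2 + 2 * √M / M₄ + B') * (kα + kβ) with hc₃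
  have hc₁0 : 0 ≤ c₁ := by positivity
  have hc₂0 : 0 ≤ c₂ := by positivity
  have hc₃0 : 0 ≤ c₃ := by positivity
  set X₂ : ℝ := m ^ (-(1 / 2) : ℝ) * lam⁻¹ with hX₂
  set Y : ℝ := lam ^ (-(1 / 2) : ℝ) with hY
  set X₃ : ℝ := Y * (a + b) with hX₃
  have hY1 : 1 ≤ Y := Real.one_le_rpow_of_pos_of_le_one_of_nonpos hlam hlam1 (by norm_num)
  have hX₂0 : 0 ≤ X₂ := by positivity
  have hX₃0 : 0 ≤ X₃ := by positivity
  have t1 : lam / 2 * r ^ 2 = c₁ * lam := by rw [hc₁]; ring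
  have t2 : 4 * C * M * (C₀ * lam⁻¹) / √(c * m) = c₂ * X₂ := by
    rw [hc₂, hX₂, hrpow _ hm.le, Real.sqrt_mul hc.le]
    field_simp
  have hBn : √(4 * M / lam) / M₄ = 2 * √M / M₄ * Y := by
    rw [hY, hrpow _ hlam.le, Real.sqrt_div (by positivity), Real.sqrt_mul (by norm_num),
      show (4 : ℝ) = 2 ^ 2 by norm_num, Real.sqrt_sq (by norm_num)]
    field_simp
  have t3 : 2 * (2 + √(4 * M / lam) / M₄ + B') ≤ 2 * (2 + 2 * √M / M₄ + B') * Y := by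
    rw [hBn]
    nlinarith
  have t4 : Iα + Iβ ≤ (kα + kβ) * (a + b) := by
    nlinarith [mul_nonneg hkα hb, mul_nonneg hkβ ha]
  have t5 := mul_le_mul t3 t4 (add_nonneg hIα hIβ) (by positivity)
  have t6 : 2 * (2 + 2 * √M / M₄ + B') * Y * ((kα + kβ) * (a + b)) = c₃ * X₃ := by
    rw [hc₃, hX₃]; ring
  rw [t6] at t5
  rw [t1, t2]
  have e : (c₁ + c₂ + c₃) * (lam + X₂ + X₃) = c₁ * lam + c₂ * X₂ + c₃ * X₃
      + (c₁ * X₂ + c₁ * X₃ + c₂ * lam + c₂ * X₃ + c₃ * lam + c₃ * X₂) := by ring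
  have : 0 ≤ c₁ * X₂ + c₁ * X₃ + c₂ * lam + c₂ * X₃ + c₃ * lam + c₃ * X₂ := by positivity
  rw [e]
  linarith

end IVPILE

/-! ### The main theorem: conditioning on the randomization. -/

theorem theorem2
    -- covariate space, law of one observation, true interval endpoints
    {d : ℕ} (𝒳 : Set (Fin d → ℝ))
    (μ : Measure (IVPILE.Obs 𝒳)) [IsProbabilityMeasure μ]
    (L U : ↥𝒳 → ℝ) (hL : Measurable L) (hU : Measurable U)
    (hLU : ∀ᵐ x ∂(IVPILE.covLaw μ), L x ≤ U x)
    -- auxiliary randomness and the random partition of the indices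
    {Ξ : Type*} [MeasurableSpace Ξ] (ν : Measure Ξ) [IsProbabilityMeasure ν]
    (I₁ I₂ : (n : ℕ) → Ξ → Finset (Fin n))
    (hImeas : ∀ n (S : Finset (Fin n)), MeasurableSet {ξ | I₁ n ξ = S})
    (hIpart : ∀ n ξ, I₂ n ξ = (I₁ n ξ)ᶜ)
    (c : ℝ) (hc : 0 < c)
    (hIcard : ∀ᶠ n : ℕ in atTop, ∀ᵐ ξ ∂ν,
      c * n ≤ ((I₁ n ξ).card : ℝ) ∧ c * n ≤ ((I₂ n ξ).card : ℝ))
    -- estimates of the endpoints, from the first part of the sample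
    (Lhat Uhat : IVPILE.FunEstimator 𝒳 Ξ)
    (hLhat : Lhat.IsMeasurable) (hUhat : Uhat.IsMeasurable)
    (hLhatI : Lhat.UsesOnly I₁) (hUhatI : Uhat.UsesOnly I₁)
    -- function class and norm
    (H : Submodule ℝ (↥𝒳 → ℝ)) (N : Seminorm ℝ H) (F F₀ : Set H)
    (hFmeas : ∀ f ∈ F, Measurable (f : ↥𝒳 → ℝ))
    -- penalty levels
    (lam : ℕ → ℝ) (hlam : ∀ n, 0 < n → 0 < lam n) (hlam0 : Tendsto lam atTop (𝓝 0))
    -- the estimator minimizes the penalized empirical risk over the second part of the sample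
    (fhat : (n : ℕ) → Ξ → (Fin n → IVPILE.Obs 𝒳) → H)
    (hfhat : IVPILE.FunEstimator.IsMeasurable (𝒳 := 𝒳) (Ξ := Ξ)
      fun n ξ s => (fhat n ξ s : ↥𝒳 → ℝ))
    (hmin : ∀ n, 0 < n → ∀ᵐ ω ∂(IVPILE.sampleLaw ν μ n),
      fhat n ω.1 ω.2 ∈ F ∧
        IsMinOn (IVPILE.empiricalObjective N (I₂ n ω.1) (Lhat n ω.1 ω.2) (Uhat n ω.1 ω.2)
          (lam n) ω.2) F (fhat n ω.1 ω.2))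
    -- existence of a finite minimizer
    (hexists : ∃ fstar ∈ F, IVPILE.surrogateRisk μ L U fstar
      = ⨅ f : F, IVPILE.surrogateRisk μ L U (f : H))
    -- boundedness conditions
    (M₁ M₂ M₃ : ℝ) (hM₁pos : 0 < M₁)
    (hM₁ : ∀ᵐ o ∂μ, |L o.cov| ≤ M₁ ∧ |U o.cov| ≤ M₁ ∧ |o.outcome| ≤ M₁)
    (hM₂ : ∀ᵐ o ∂μ, ∀ i, |(o.cov : Fin d → ℝ) i| ≤ M₂)
    (hM₃ : ∀ n, 0 < n → ∀ᵐ q ∂((IVPILE.sampleLaw ν μ n).prod (IVPILE.covLaw μ)),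
      |Lhat n q.1.1 q.1.2 q.2| ≤ M₃ ∧ |Uhat n q.1.1 q.1.2 q.2| ≤ M₃)
    -- entropy condition
    (C₀ v : ℝ) (hC₀ : 0 < C₀) (hv : 0 < v) (hv2 : v < 2)
    (hF₀F : F₀ ⊆ F)
    (hF : F = {g : H | ∃ a : ℝ, ∃ f ∈ F₀, g = a • f})
    (hfhatF₀ : ∀ n, 0 < n → ∀ᵐ ω ∂(IVPILE.sampleLaw ν μ n),
      ∃ a : ℝ, |a| ≤ C₀ * (lam n)⁻¹ ∧ ∃ f ∈ F₀, fhat n ω.1 ω.2 = a • f)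
    (hentropy : IVPILE.HasUniformEntropy ((fun f : H => (f : ↥𝒳 → ℝ)) '' F₀) v)
    -- rates of convergence of the estimated endpoints
    (α β : ℝ)
    (hα : (fun n : ℕ => ∫ q, |Lhat n q.1.1 q.1.2 q.2 - L q.2|
        ∂((IVPILE.sampleLaw ν μ n).prod (IVPILE.covLaw μ)))
      =O[atTop] fun n : ℕ => (n : ℝ) ^ (-α))
    (hβ : (fun n : ℕ => ∫ q, |Uhat n q.1.1 q.1.2 q.2 - U q.2|
        ∂((IVPILE.sampleLaw ν μ n).prod (IVPILE.covLaw μ)))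
      =O[atTop] fun n : ℕ => (n : ℝ) ^ (-β))
    -- norm condition
    (M₄ : ℝ) (hM₄ : 0 < M₄)
    (hnorm : ∀ f ∈ F, ∀ x, M₄ * |(f : ↥𝒳 → ℝ) x| ≤ N f) :
    (∀ n, 0 < n → Integrable
      (fun ω => IVPILE.surrogateRisk μ L U (fhat n ω.1 ω.2)) (IVPILE.sampleLaw ν μ n)) ∧
    ∃ C : ℝ, ∀ᶠ n : ℕ in atTop,
      (∫ ω, IVPILE.surrogateRisk μ L U (fhat n ω.1 ω.2) ∂(IVPILE.sampleLaw ν μ n))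
          - ⨅ f : F, IVPILE.surrogateRisk μ L U (f : H)
        ≤ C * (lam n + (n : ℝ) ^ (-(1 / 2) : ℝ) * (lam n)⁻¹
            + (lam n) ^ (-(1 / 2) : ℝ) * ((n : ℝ) ^ (-α) + (n : ℝ) ^ (-β))) := by
  have hcov : Measurable (IVPILE.Obs.cov (𝒳 := 𝒳)) := measurable_fst
  set M : ℝ := max M₁ M₃ with hM
  have hM0 : 0 < M := lt_max_of_lt_left hM₁pos
  have hPp : IsProbabilityMeasure (IVPILE.covLaw μ) :=
    Measure.isProbabilityMeasure_map hcov.aemeasurable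
  set P := IVPILE.covLaw μ with hP
  have hsample : ∀ n, IsProbabilityMeasure (IVPILE.sampleLaw ν μ n) := fun n => by
    unfold IVPILE.sampleLaw
    infer_instance
  have hLUM : ∀ᵐ x ∂P, |L x| ≤ M ∧ |U x| ≤ M := by
    have hms : MeasurableSet {x | |L x| ≤ M ∧ |U x| ≤ M} :=
      (measurableSet_le hL.abs measurable_const).inter (measurableSet_le hU.abs measurable_const)
    refine (ae_map_iff hcov.aemeasurable hms).2 ?_
    filter_upwards [hM₁] with o ho
    exact ⟨ho.1.trans (le_max_left _ _), ho.2.1.trans (le_max_left _ _)⟩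
  obtain ⟨fstar, hfstarF, hfstar⟩ := hexists
  obtain ⟨f₀, hf₀, -⟩ : ∃ f ∈ F₀, True := by
    have h := hfstarF
    rw [hF] at h
    obtain ⟨a, f, hf, -⟩ := h
    exact ⟨f, hf, trivial⟩
  have h0F : (0 : H) ∈ F := by
    rw [hF]
    exact ⟨0, f₀, hf₀, by simp⟩
  have hbddF : ∀ f ∈ F, ∀ x, |(f : ↥𝒳 → ℝ) x| ≤ N f / M₄ := fun f hf x => by
    rw [le_div_iff₀ hM₄, mul_comm]
    exact hnorm f hf x
  set S : Set (↥𝒳 → ℝ) := (fun f : H => (f : ↥𝒳 → ℝ)) '' F₀ with hS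
  obtain ⟨C, hC0, hC⟩ := IVPILE.exists_rademacher_bound (S := S)
    (by rintro _ ⟨f, hf, rfl⟩; exact hFmeas f (hF₀F hf))
    (by rintro _ ⟨f, hf, rfl⟩; exact ⟨_, hbddF f (hF₀F hf)⟩) hv hv2 hentropy
  set B : ℕ → ℝ := fun n => √(4 * M / lam n) / M₄ with hBdef
  set B' : ℝ := N fstar / M₄ with hB'def
  have hB'0 : 0 ≤ B' := div_nonneg (apply_nonneg N fstar) hM₄.le
  set e : (n : ℕ) → (Ξ × (Fin n → IVPILE.Obs 𝒳)) × ↥𝒳 ≃ᵐ Ξ × (Fin n → IVPILE.Obs 𝒳) × ↥𝒳 :=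
    fun n => MeasurableEquiv.prodAssoc with he
  -- Regrouping puts the randomization outermost, so that the partition can be frozen.
  have hassoc : ∀ n, MeasurePreserving (e n) ((IVPILE.sampleLaw ν μ n).prod P)
      (ν.prod ((Measure.pi fun _ : Fin n => μ).prod P)) := fun n =>
    measurePreserving_prodAssoc ν (Measure.pi fun _ : Fin n => μ) P
  -- boundedness of the estimates, for almost every value of the randomization
  have hMξ : ∀ n, 0 < n → ∀ᵐ ξ ∂ν, ∀ᵐ q ∂((Measure.pi fun _ : Fin n => μ).prod P),
      |Lhat n ξ q.1 q.2| ≤ M ∧ |Uhat n ξ q.1 q.2| ≤ M := by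
    intro n hn
    have h := (hassoc n).symm.quasiMeasurePreserving.ae (hM₃ n hn)
    filter_upwards [Measure.ae_ae_of_ae_prod h] with ξ hξ
    filter_upwards [hξ] with q hq
    exact ⟨hq.1.trans (le_max_right _ _), hq.2.trans (le_max_right _ _)⟩
  have hsplit : ∀ (g : (n : ℕ) → Ξ → (Fin n → IVPILE.Obs 𝒳) → ↥𝒳 → ℝ),
      IVPILE.FunEstimator.UsesOnly g I₁ → ∀ n ξ (s s' : Fin n → IVPILE.Obs 𝒳),
      (∀ i ∉ I₂ n ξ, s i = s' i) → g n ξ s = g n ξ s' := by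
    intro g hg n ξ s s' h
    refine hg n ξ fun i hi => h i ?_
    rw [hIpart]
    simpa using hi
  have hslice : ∀ (g : (n : ℕ) → Ξ → (Fin n → IVPILE.Obs 𝒳) → ↥𝒳 → ℝ),
      IVPILE.FunEstimator.IsMeasurable g → ∀ n ξ,
      Measurable fun q : (Fin n → IVPILE.Obs 𝒳) × ↥𝒳 => g n ξ q.1 q.2 := fun g hg n ξ =>
    (hg n).comp ((measurable_const.prodMk measurable_fst).prodMk measurable_snd)
  have hBξ : ∀ n, 0 < n → ∀ᵐ ξ ∂ν, ∀ᵐ s ∂(Measure.pi fun _ : Fin n => μ), ∀ x,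
      |(fhat n ξ s : ↥𝒳 → ℝ) x| ≤ B n := by
    intro n hn
    filter_upwards [hMξ n hn, Measure.ae_ae_of_ae_prod (hmin n hn)] with ξ h1 h2
    have h3 := IVPILE.ae_train_of_ae (J := I₂ n ξ) (l := fun s => (Lhat n ξ s, Uhat n ξ s)) μ
      (fun s s' h => by
        rw [hsplit Lhat hLhatI n ξ s s' h, hsplit Uhat hUhatI n ξ s s' h]) hcov
      (Q := fun b x => |b.1 x| ≤ M ∧ |b.2 x| ≤ M) h1
    filter_upwards [h2, h3] with s h4 h5
    exact IVPILE.abs_le_of_isMinOn_empiricalObjective (hlam n hn) hM0.le hM₄ h0F h4.2 h5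
      (hnorm _ h4.1)
  -- integrability of the loss of the estimator
  have hloss : ∀ n, 0 < n → Integrable (fun q : (Ξ × (Fin n → IVPILE.Obs 𝒳)) × ↥𝒳 =>
      IVPILE.surrogateLoss (L q.2) (U q.2) ((fhat n q.1.1 q.1.2 : ↥𝒳 → ℝ) q.2))
      ((IVPILE.sampleLaw ν μ n).prod P) := by
    intro n hn
    have hBq : ∀ᵐ q ∂((IVPILE.sampleLaw ν μ n).prod P),
        |(fhat n q.1.1 q.1.2 : ↥𝒳 → ℝ) q.2| ≤ B n := by
      -- Returning from fibrewise to joint almost everywhere statements requires a measurable set.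
      have hms : MeasurableSet {r : Ξ × (Fin n → IVPILE.Obs 𝒳) × ↥𝒳 |
          |(fhat n r.1 r.2.1 : ↥𝒳 → ℝ) r.2.2| ≤ B n} :=
        (measurableSet_le (hfhat n).abs measurable_const).preimage (e n).symm.measurable
      refine (hassoc n).quasiMeasurePreserving.ae ((Measure.ae_prod_iff_ae_ae hms).2 ?_)
      filter_upwards [hBξ n hn] with ξ hξ
      exact (Measure.quasiMeasurePreserving_fst.ae hξ).mono fun q hq => hq q.2
    refine Integrable.of_bound (IVPILE.measurable_surrogateLoss (hL.comp measurable_snd)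
      (hU.comp measurable_snd) (hfhat n)).aestronglyMeasurable (2 * M * (1 + B n)) ?_
    filter_upwards [hBq, Measure.quasiMeasurePreserving_snd.ae hLUM] with q h1 h2
    rw [Real.norm_of_nonneg (IVPILE.surrogateLoss_nonneg _ _ _)]
    refine (IVPILE.surrogateLoss_le _ _ _).trans ?_
    exact mul_le_mul (by linarith) (by linarith) (by positivity) (by positivity)
  refine ⟨fun n hn => (hloss n hn).integral_prod_left, ?_⟩
  have hest : ∀ (g : (n : ℕ) → Ξ → (Fin n → IVPILE.Obs 𝒳) → ↥𝒳 → ℝ) (G : ↥𝒳 → ℝ),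
      IVPILE.FunEstimator.IsMeasurable g → Measurable G →
      (∀ n, 0 < n → ∀ᵐ q ∂((IVPILE.sampleLaw ν μ n).prod P), |g n q.1.1 q.1.2 q.2| ≤ M₃) →
      (∀ᵐ x ∂P, |G x| ≤ M) → ∀ n, 0 < n →
      Integrable (fun q : (Ξ × (Fin n → IVPILE.Obs 𝒳)) × ↥𝒳 => |g n q.1.1 q.1.2 q.2 - G q.2|)
        ((IVPILE.sampleLaw ν μ n).prod P) := by
    intro g G hg hG hgM hGM n hn
    refine Integrable.of_bound
      ((hg n).sub (hG.comp measurable_snd)).abs.aestronglyMeasurable (M₃ + M) ?_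
    filter_upwards [hgM n hn, Measure.quasiMeasurePreserving_snd.ae hGM] with q h1 h2
    rw [Real.norm_of_nonneg (abs_nonneg _)]
    exact (abs_sub _ _).trans (add_le_add h1 h2)
  have hiL := hest Lhat L hLhat hL (fun n hn => (hM₃ n hn).mono fun q hq => hq.1)
    (hLUM.mono fun x hx => hx.1)
  have hiU := hest Uhat U hUhat hU (fun n hn => (hM₃ n hn).mono fun q hq => hq.2)
    (hLUM.mono fun x hx => hx.2)
  -- the oracle inequality for almost every value of the randomization
  set Rstar : ℝ := ⨅ f : F, IVPILE.surrogateRisk μ L U (f : H) with hRstar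
  have horacle : ∀ᶠ n : ℕ in atTop,
      (∫ ω, IVPILE.surrogateRisk μ L U (fhat n ω.1 ω.2) ∂(IVPILE.sampleLaw ν μ n)) - Rstar
        ≤ lam n / 2 * N fstar ^ 2 + 4 * C * M * (C₀ * (lam n)⁻¹) / √(c * n)
          + 2 * (2 + B n + B') *
            ((∫ q, |Lhat n q.1.1 q.1.2 q.2 - L q.2| ∂((IVPILE.sampleLaw ν μ n).prod P))
              + ∫ q, |Uhat n q.1.1 q.1.2 q.2 - U q.2| ∂((IVPILE.sampleLaw ν μ n).prod P)) := by
    filter_upwards [hIcard, eventually_gt_atTop 0] with n hcard hn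
    have hlamn := hlam n hn
    have hn' : (0 : ℝ) < n := by exact_mod_cast hn
    set Δ : Ξ → (Fin n → IVPILE.Obs 𝒳) × ↥𝒳 → ℝ := fun ξ q =>
      |Lhat n ξ q.1 q.2 - L q.2| + |Uhat n ξ q.1 q.2 - U q.2| with hΔ
    have hξ : ∀ᵐ ξ ∂ν,
        ∫ q, IVPILE.surrogateLoss (L q.2) (U q.2) ((fhat n ξ q.1 : ↥𝒳 → ℝ) q.2)
            ∂((Measure.pi fun _ : Fin n => μ).prod P)
          ≤ Rstar + lam n / 2 * N fstar ^ 2 + 4 * C * M * (C₀ * (lam n)⁻¹) / √(c * n)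
            + 2 * (2 + B n + B') * ∫ q, Δ ξ q ∂((Measure.pi fun _ : Fin n => μ).prod P) := by
      filter_upwards [hcard, hMξ n hn, hBξ n hn, Measure.ae_ae_of_ae_prod (hmin n hn),
        Measure.ae_ae_of_ae_prod (hfhatF₀ n hn)] with ξ h1 h2 h3 h4 h5
      have hcn : 0 < c * n := by positivity
      have hJ : (I₂ n ξ).Nonempty := by
        rw [← Finset.card_pos]
        exact_mod_cast hcn.trans_le h1.2
      have hor := IVPILE.integral_surrogateLoss_sub_le μ hcov hJ
        (l := Lhat n ξ) (u := Uhat n ξ) (h := fun s => (fhat n ξ s : ↥𝒳 → ℝ))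
        (hsplit Lhat hLhatI n ξ) (hsplit Uhat hUhatI n ξ)
        (hslice Lhat hLhat n ξ) (hslice Uhat hUhat n ξ) (hslice _ hfhat n ξ)
        (A := C₀ * (lam n)⁻¹) (C := C) (S := S) (Λ := lam n / 2 * N fstar ^ 2)
        hM0 (by positivity) h2 h3
        (by
          filter_upwards [h5] with s hs
          obtain ⟨a, ha, f, hf, hfa⟩ := hs
          exact ⟨a, ha, f, ⟨f, hf, rfl⟩, fun x => by simp [hfa]⟩)
        (fun x φ => hC n (I₂ n ξ) x φ) hL hU (hFmeas fstar hfstarF) hLU hLUM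
        (hbddF fstar hfstarF)
        (by
          filter_upwards [h4] with s hs
          have h6 : IVPILE.empiricalObjective N (I₂ n ξ) (Lhat n ξ s) (Uhat n ξ s) (lam n) s
              (fhat n ξ s) ≤ IVPILE.empiricalObjective N (I₂ n ξ) (Lhat n ξ s) (Uhat n ξ s)
              (lam n) s fstar := hs.2 hfstarF
          -- The penalty of the estimator is discarded; that of `fstar` is the slack `Λ`.
          have h7 : 0 ≤ lam n / 2 * N (fhat n ξ s) ^ 2 := by positivity
          simp only [IVPILE.empiricalObjective] at h6
          simp only [IVPILE.hingeTerm]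
          linarith)
      have hsq : 4 * C * M * (C₀ * (lam n)⁻¹) / √(I₂ n ξ).card
          ≤ 4 * C * M * (C₀ * (lam n)⁻¹) / √(c * n) :=
        div_le_div_of_nonneg_left (by positivity) (Real.sqrt_pos.2 hcn)
          (Real.sqrt_le_sqrt h1.2)
      have hR : Rstar = ∫ x, IVPILE.surrogateLoss (L x) (U x) ((fstar : ↥𝒳 → ℝ) x) ∂P :=
        hfstar.symm
      rw [show Measure.map IVPILE.Obs.cov μ = P from rfl, ← hR] at hor
      simp only [hΔ]
      linarith
    have hi3 : Integrable (fun r : Ξ × (Fin n → IVPILE.Obs 𝒳) × ↥𝒳 =>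
        IVPILE.surrogateLoss (L r.2.2) (U r.2.2) ((fhat n r.1 r.2.1 : ↥𝒳 → ℝ) r.2.2))
        (ν.prod ((Measure.pi fun _ : Fin n => μ).prod P)) :=
      (hassoc n).symm.integrable_comp_of_integrable (hloss n hn)
    have hi4 : Integrable (fun r : Ξ × (Fin n → IVPILE.Obs 𝒳) × ↥𝒳 => Δ r.1 r.2)
        (ν.prod ((Measure.pi fun _ : Fin n => μ).prod P)) :=
      (hassoc n).symm.integrable_comp_of_integrable ((hiL n hn).add (hiU n hn))
    have he1 : ∫ ω, IVPILE.surrogateRisk μ L U (fhat n ω.1 ω.2) ∂(IVPILE.sampleLaw ν μ n)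
        = ∫ ξ, ∫ q, IVPILE.surrogateLoss (L q.2) (U q.2) ((fhat n ξ q.1 : ↥𝒳 → ℝ) q.2)
            ∂((Measure.pi fun _ : Fin n => μ).prod P) ∂ν :=
      (integral_prod _ (hloss n hn)).symm.trans
        (((hassoc n).integral_comp (e n).measurableEmbedding
          fun r : Ξ × (Fin n → IVPILE.Obs 𝒳) × ↥𝒳 =>
            IVPILE.surrogateLoss (L r.2.2) (U r.2.2) ((fhat n r.1 r.2.1 : ↥𝒳 → ℝ) r.2.2)).trans
          (integral_prod _ hi3))
    have he2 : (∫ q, |Lhat n q.1.1 q.1.2 q.2 - L q.2| ∂((IVPILE.sampleLaw ν μ n).prod P))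
          + ∫ q, |Uhat n q.1.1 q.1.2 q.2 - U q.2| ∂((IVPILE.sampleLaw ν μ n).prod P)
        = ∫ ξ, ∫ q, Δ ξ q ∂((Measure.pi fun _ : Fin n => μ).prod P) ∂ν :=
      (integral_add (hiL n hn) (hiU n hn)).symm.trans
        (((hassoc n).integral_comp (e n).measurableEmbedding
          fun r : Ξ × (Fin n → IVPILE.Obs 𝒳) × ↥𝒳 => Δ r.1 r.2).trans (integral_prod _ hi4))
    have hmono := integral_mono_ae hi3.integral_prod_left
      ((integrable_const (Rstar + lam n / 2 * N fstar ^ 2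
        + 4 * C * M * (C₀ * (lam n)⁻¹) / √(c * n))).add
        (hi4.integral_prod_left.const_mul (2 * (2 + B n + B')))) hξ
    rw [integral_add' (integrable_const _) (hi4.integral_prod_left.const_mul _), integral_const,
      probReal_univ, one_smul, integral_const_mul] at hmono
    rw [he1, he2]
    linarith
  -- rates
  obtain ⟨kα, hkα0, hkα⟩ := hα.exists_nonneg
  obtain ⟨kβ, hkβ0, hkβ⟩ := hβ.exists_nonneg
  refine ⟨N fstar ^ 2 / 2 + 4 * C * M * C₀ / √c
    + 2 * (2 + 2 * √M / M₄ + B') * (kα + kβ), ?_⟩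
  filter_upwards [horacle, hkα.bound, hkβ.bound, eventually_gt_atTop 0,
    hlam0.eventually (gt_mem_nhds one_pos)] with n h1 h2 h3 hn hlam1
  have hnα : 0 ≤ (n : ℝ) ^ (-α) := by positivity
  have hnβ : 0 ≤ (n : ℝ) ^ (-β) := by positivity
  rw [Real.norm_of_nonneg hnα, Real.norm_of_nonneg (integral_nonneg fun _ => abs_nonneg _)] at h2
  rw [Real.norm_of_nonneg hnβ, Real.norm_of_nonneg (integral_nonneg fun _ => abs_nonneg _)] at h3
  exact h1.trans (IVPILE.oracle_rate_le (by exact_mod_cast hn) (hlam n hn) hlam1.le hc hM0.le hM₄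
    hB'0 hC0 hC₀.le hkα0 hkβ0 hnα hnβ (integral_nonneg fun _ => abs_nonneg _)
    (integral_nonneg fun _ => abs_nonneg _) h2 h3)
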